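/- Let $\mathcal E_B,\mathcal E_T$ be quantum channels (normal completely positive trace-preserving maps) on one bosonic mode, for example Gaussian phase-insensitive channels with a background and a target transmissivity and noise. For a pattern $i\in\{B,T\}^m$ put $\mathcal E_i=\mathcal E_{i_1}\otimes\cdots\otimes\mathcal E_{i_m}$. All $2^m$ patterns are equally likely (barcode image space); a probe state $\Phi$ on the $m$ modes, possibly together with an idler mode on which the identity channel $\mathcal I$ acts, is sent through the pattern $M$ times, $M\in\mathbb N$, and with $\rho_i=\mathcal E_i(\Phi)$ (resp. $(\mathcal E_i\otimes\mathcal I)(\Phi)$) $$p_{\rm err}=\inf_{\{\Pi_j\}}\ \sum_{i\ne i'}2^{-m}\,\mathrm{Tr}\big[\Pi_{i'}\,\rho_i^{\otimes M}\big],$$ the infimum being over all POVMs with outcomes in $\{B,T\}^m$. Let $F(\rho,\sigma)=\mathrm{Tr}\sqrt{\sqrt\rho\,\sigma\sqrt\rho}$ be the Bures fidelity. For $N\ge 0$ let $\Phi_\mu$, $\mu=N+\frac12$, be the two-mode squeezed vacuum (TMSV) state with vector $\sum_n \sqrt{N^n/(N+1)^{n+1}}\,|n\rangle|n\rangle$,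 and for $a,b\in\{B,T\}$ put $\varphi_{ab}=(\mathcal E_a\otimes\mathcal E_b)(\Phi_\mu)$. Then, for $(a,b)\neq(a',b')$, the fidelity $F(\varphi_{ab},\varphi_{a'b'})$ depends only on the unordered pair $\{v,u\}$ of the numbers $v$ and $u$ of letters $T$ in $(a,b)$ and in $(a',b')$; its values for $(v,u)=(0,1),(1,2),(1,1),(0,2)$ are denoted $F_{01},F_{12},F_{11},F_{02}$. Define, for $K\in\mathbb N$, $$D_2[K]=1+F_{01}^{K}+F_{12}^{K}+\frac{F_{11}^{K}+F_{02}^{K}}{2}.$$ (a) Let $m$ be even and let $\Phi$ be the product of $m/2$ TMSV states $\Phi_\mu$ on disjoint pairs of modes (any partition of the $m$ modes into pairs). Then $$\frac{D_2[2M]^{m/2}-1}{2^{m+1}}\ \le\ p_{\rm err}\ \le\ D_2[M]^{m/2}-1 .$$ (b) Let $m$ be odd and let $\Phi$ be the product of $(m-1)/2$ TMSV states $\Phi_\mu$ on disjoint pairs of modes and a coherent state $|\alpha\rangle\langle\alpha|$, with arbitrary $\alpha\in\mathbb C$, on the remaining mode. With $F_{\rm cl}=F\big(\mathcal E_B(|\alpha\rangle\langle\alpha|),\mathcal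 E_T(|\alpha\rangle\langle\alpha|)\big)$, $$\frac{(1+F_{\rm cl}^{2M})\,D_2[2M]^{(m-1)/2}-1}{2^{m+1}}\ \le\ p_{\rm err}\ \le\ (1+F_{\rm cl}^{M})\,D_2[M]^{(m-1)/2}-1 .$$ (c) Let $m$ be odd and let $\Phi$ be the product of $(m-1)/2$ TMSV states $\Phi_\mu$ on disjoint pairs of modes and a TMSV state $\Phi_\mu$ shared by the remaining mode and one idler mode. With $F_{\rm Choi}=F\big((\mathcal E_B\otimes\mathcal I)(\Phi_\mu),(\mathcal E_T\otimes\mathcal I)(\Phi_\mu)\big)$, $$\frac{(1+F_{\rm Choi}^{2M})\,D_2[2M]^{(m-1)/2}-1}{2^{m+1}}\ \le\ p_{\rm err}\ \le\ (1+F_{\rm Choi}^{M})\,D_2[M]^{(m-1)/2}-1 .$$ -/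

import Mathlib

open scoped lp NNReal

namespace BosonicDiscrimination

noncomputable section

/-! ### Hilbert spaces with a distinguished orthonormal basis -/

/-- The Hilbert space with orthonormal basis labelled by `X`.  One bosonic mode is `H ℕ` (Fock
basis), `n` modes are `H (Fin n → ℕ)` (joint photon numbers), and `M` copies of a system `H X`
are `H (Fin M → X)`, the Hilbert-space tensor power. -/
abbrev H (X : Type) : Type := ℓ²(X, ℂ)

/-- Bounded operators. -/
abbrev Op (X : Type) : Type := H X →L[ℂ] H X

/-- The basis vector with label `a`. -/
def ket {X : Type} (a : X) : H X := by
  classical exact lp.single 2 a 1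

/-- The trace `∑ₐ ⟨a| A |a⟩`. -/
def tr {X : Type} (A : Op X) : ℂ := ∑' a : X, inner ℂ (ket a) (A (ket a))

/-- The pure state `|v⟩⟨v|`. -/
def pureState {X : Type} (v : H X) : Op X := InnerProductSpace.rankOne ℂ v v

/-- The positive square root of a positive operator, by the continuous functional calculus. -/
def opSqrt {V : Type} [NormedAddCommGroup V] [InnerProductSpace ℂ V] [CompleteSpace V]
    (A : V →L[ℂ] V) : V →L[ℂ] V := CFC.sqrt A

/-- The Bures fidelity `F(ρ, σ) = Tr √(√ρ σ √ρ)` (without the square). -/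
def fidelity {X : Type} (ρ σ : Op X) : ℝ :=
  (tr (opSqrt (opSqrt ρ * σ * opSqrt ρ))).re

/-! ### Tensor products of operators -/

theorem summable_sq {X : Type} (ψ : H X) : Summable fun x => ‖ψ x‖ ^ 2 := by
  simpa using (lp.memℓp ψ).summable (by norm_num)

theorem memℓp_two {X : Type} {f : X → ℂ} (h : Summable fun x => ‖f x‖ ^ 2) :
    Memℓp f 2 := memℓp_gen (by simpa using h)

theorem hasSum_norm_sq {X : Type} (ψ : H X) : HasSum (fun x => ‖ψ x‖ ^ 2) (‖ψ‖ ^ 2) := by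
  simpa using lp.hasSum_norm (p := 2) (by norm_num) ψ

/-- All tensor factors but the `s`-th being fixed to the labels in `f`, the dependence of `ψ` on
the label of the `s`-th factor. -/
def slice {X : Type} {n : ℕ} (s : Fin n) (ψ : H (Fin n → X)) (f : Fin n → X) : H X :=
  ⟨fun x => ψ (Function.update f s x),
    memℓp_two ((summable_sq ψ).comp_injective (Function.update_injective f s))⟩

theorem slice_update {X : Type} {n : ℕ} (s : Fin n) (ψ : H (Fin n → X)) (f : Fin n → X) (x : X) :
    slice s ψ (Function.update f s x) = slice s ψ f := by
  ext y
  simp [slice]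

/-- Splitting off the `s`-th label. -/
def splitEquiv {X : Type} {n : ℕ} (s : Fin n) : ({j // j ≠ s} → X) × X ≃ (Fin n → X) :=
  (Equiv.prodComm _ _).trans (Equiv.funSplitAt s X).symm

theorem slice_splitEquiv {X : Type} {n : ℕ} (s : Fin n) (ψ : H (Fin n → X))
    (g : {j // j ≠ s} → X) (x y : X) :
    slice s ψ (splitEquiv s (g, x)) y = ψ (splitEquiv s (g, y)) := by
  have : Function.update (splitEquiv s (g, x)) s y = splitEquiv s (g, y) := by
    funext j
    by_cases h : j = s
    · subst h; simp [splitEquiv, Equiv.funSplitAt, Equiv.piSplitAt]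
    · simp [splitEquiv, Equiv.funSplitAt, Equiv.piSplitAt, h]
  simp [slice, this]

theorem splitEquiv_self {X : Type} {n : ℕ} (s : Fin n) (g : {j // j ≠ s} → X) (x : X) :
    splitEquiv s (g, x) s = x := by
  simp [splitEquiv, Equiv.funSplitAt, Equiv.piSplitAt]

theorem localOp_summable {X : Type} {n : ℕ} (s : Fin n) (A : Op X) (ψ : H (Fin n → X)) :
    (Summable fun f => ‖A (slice s ψ f) (f s)‖ ^ 2) ∧
      ∑' f, ‖A (slice s ψ f) (f s)‖ ^ 2 ≤ ‖A‖ ^ 2 * ‖ψ‖ ^ 2 := by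
  classical
  -- the slice depends only on the labels other than the `s`-th
  have key : ∀ g : {j // j ≠ s} → X, ∃ φ : H X, (∀ x, slice s ψ (splitEquiv s (g, x)) = φ) ∧
      ∀ x, φ x = ψ (splitEquiv s (g, x)) := by
    intro g
    by_cases hX : Nonempty X
    · obtain ⟨x₀⟩ := hX
      refine ⟨slice s ψ (splitEquiv s (g, x₀)), fun x => ?_, fun x => slice_splitEquiv s ψ g x₀ x⟩
      ext y
      rw [slice_splitEquiv, slice_splitEquiv]
    · exact ⟨0, fun x => (hX ⟨x⟩).elim, fun x => (hX ⟨x⟩).elim⟩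
  choose φ hφ hφ' using key
  have hψ : Summable fun p : ({j // j ≠ s} → X) × X => ‖ψ (splitEquiv s p)‖ ^ 2 :=
    (summable_sq ψ).comp_injective (splitEquiv s).injective
  have hψt : ∑' p : ({j // j ≠ s} → X) × X, ‖ψ (splitEquiv s p)‖ ^ 2 = ‖ψ‖ ^ 2 := by
    rw [(splitEquiv s).tsum_eq (fun f => ‖ψ f‖ ^ 2)]
    exact (hasSum_norm_sq ψ).tsum_eq
  have hφn : ∀ g, ∑' x, ‖ψ (splitEquiv s (g, x))‖ ^ 2 = ‖φ g‖ ^ 2 := by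
    intro g
    rw [← (hasSum_norm_sq (φ g)).tsum_eq]
    simp [hφ']
  have hsum : Summable fun g => ‖φ g‖ ^ 2 := by
    have := ((summable_prod_of_nonneg (fun p => by positivity)).1 hψ).2
    simpa only [hφn] using this
  have hsumt : ∑' g, ‖φ g‖ ^ 2 = ‖ψ‖ ^ 2 := by
    rw [← hψt, hψ.tsum_prod]
    simp only [hφn]
  have hle : ∀ g, ‖A (φ g)‖ ^ 2 ≤ ‖A‖ ^ 2 * ‖φ g‖ ^ 2 := by
    intro g
    rw [← mul_pow]
    exact pow_le_pow_left₀ (norm_nonneg _) (A.le_opNorm _) 2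
  have hAsum : Summable fun g => ‖A (φ g)‖ ^ 2 :=
    Summable.of_nonneg_of_le (fun _ => by positivity) hle (hsum.mul_left _)
  have hA : Summable fun p : ({j // j ≠ s} → X) × X => ‖A (φ p.1) p.2‖ ^ 2 := by
    refine (summable_prod_of_nonneg (fun p => by positivity)).2 ⟨fun g => ?_, ?_⟩
    · exact summable_sq (A (φ g))
    · simpa only [(hasSum_norm_sq _).tsum_eq] using hAsum
  have heq : ∀ p : ({j // j ≠ s} → X) × X,
      ‖A (slice s ψ (splitEquiv s p)) (splitEquiv s p s)‖ ^ 2 = ‖A (φ p.1) p.2‖ ^ 2 := by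
    rintro ⟨g, x⟩
    rw [hφ, splitEquiv_self]
  constructor
  · rw [← (splitEquiv s).summable_iff]
    exact hA.congr fun p => (heq p).symm
  · rw [← (splitEquiv s).tsum_eq, tsum_congr heq, hA.tsum_prod]
    simp only [(hasSum_norm_sq _).tsum_eq]
    calc ∑' g, ‖A (φ g)‖ ^ 2 ≤ ∑' g, ‖A‖ ^ 2 * ‖φ g‖ ^ 2 :=
          hAsum.tsum_le_tsum hle (hsum.mul_left _)
      _ = ‖A‖ ^ 2 * ‖ψ‖ ^ 2 := by rw [tsum_mul_left, hsumt]

/-- The operator `1 ⊗ ⋯ ⊗ A ⊗ ⋯ ⊗ 1` acting as `A` on the `s`-th tensor factor. -/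
def localOp {X : Type} {n : ℕ} (s : Fin n) (A : Op X) : Op (Fin n → X) :=
  LinearMap.mkContinuous
    { toFun := fun ψ => ⟨fun f => A (slice s ψ f) (f s), memℓp_two (localOp_summable s A ψ).1⟩
      map_add' := fun ψ φ => by
        ext f
        have : slice s (ψ + φ) f = slice s ψ f + slice s φ f := by ext; rfl
        simp [this]
        rfl
      map_smul' := fun c ψ => by
        ext f
        have : slice s (c • ψ) f = c • slice s ψ f := by ext; rfl
        simp [this] }
    ‖A‖ fun ψ => by
      refine lp.norm_le_of_tsum_le (by norm_num) (by positivity) ?_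
      simpa [mul_pow] using (localOp_summable s A ψ).2

/-- The tensor product `A₀ ⊗ A₁ ⊗ ⋯ ⊗ Aₙ₋₁`, as the product of the commuting operators
`1 ⊗ ⋯ ⊗ Aₛ ⊗ ⋯ ⊗ 1`. -/
def tensorOp {X : Type} {n : ℕ} (A : Fin n → Op X) : Op (Fin n → X) :=
  (List.ofFn fun s => localOp s (A s)).prod

/-- The `M`-fold tensor power `ρ^{⊗ M}`. -/
def tensorPow {X : Type} (M : ℕ) (ρ : Op X) : Op (Fin M → X) := tensorOp fun _ => ρ

/-! ### Quantum channels -/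

/-- A quantum channel on one bosonic mode, given by Kraus operators with `∑ₖ Kₖ† Kₖ = 1`, the
series converging weakly.  Every normal completely positive trace-preserving map on the (separable)
space of a mode has this form, in particular every Gaussian phase-insensitive channel. -/
structure Channel where
  kraus : ℕ → Op ℕ
  complete : ∀ v : H ℕ, HasSum (fun k => ‖kraus k v‖ ^ 2) (‖v‖ ^ 2)

/-- The action `ρ ↦ ∑ₖ Kₖ ρ Kₖ†`. -/
def krausMap {X ι : Type} (K : ι → Op X) (ρ : Op X) : Op X :=
  ∑' k, K k * ρ * star (K k)

/-- The output of a channel. -/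
def Channel.apply (E : Channel) (ρ : Op ℕ) : Op ℕ := krausMap E.kraus ρ

/-- The identity channel. -/
def Channel.id : Channel where
  kraus k := if k = 0 then 1 else 0
  complete v := by
    convert hasSum_ite_eq (0 : ℕ) (‖v‖ ^ 2) using 2 with k
    split_ifs <;> simp

/-- The product channel `E₀ ⊗ ⋯ ⊗ Eₙ₋₁` on `n` modes: its Kraus operators are the tensor products
of those of the factors. -/
def productChannel {n : ℕ} (E : Fin n → Channel) (ρ : Op (Fin n → ℕ)) : Op (Fin n → ℕ) :=
  krausMap (fun κ : Fin n → ℕ => tensorOp fun s => (E s).kraus (κ s)) ρ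

/-! ### Discrimination of states -/

/-- A measurement with outcomes in `I`. -/
structure POVM (I X : Type) [Fintype I] where
  effect : I → Op X
  nonneg : ∀ i, 0 ≤ effect i
  sum_eq_one : ∑ i, effect i = 1

/-- The probability `∑_{i ≠ i'} πᵢ Tr[Πᵢ' ρᵢ]` of misclassification. -/
def errorProb {I X : Type} [Fintype I] [DecidableEq I] (p : I → ℝ) (ρ : I → Op X)
    (P : POVM I X) : ℝ :=
  ∑ i, ∑ i' ∈ Finset.univ.filter (fun i' => i' ≠ i), p i * (tr (P.effect i' * ρ i)).re

/-- The error probability for an optimised measurement. -/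
def minErrorProb {I X : Type} [Fintype I] [DecidableEq I] (p : I → ℝ) (ρ : I → Op X) : ℝ :=
  ⨅ P : POVM I X, errorProb p ρ P

/-- Patterns of `m` channels: `false` is a background channel and `true` is a target channel. -/
abbrev Pattern (m : ℕ) : Type := Fin m → Bool

/-- The error probability for the uniform (barcode) image space of all `2 ^ m` patterns, for `M`
copies of the output states `ρ i`. -/
def barcodeErrorProb {X : Type} (m M : ℕ) (ρ : Pattern m → Op X) : ℝ :=
  minErrorProb (fun _ : Pattern m => 1 / (2 : ℝ) ^ m) fun i => tensorPow M (ρ i)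

/-! ### Probe states

`N` is the mean photon number per mode, so the quadrature variance is `μ = N + 1/2` and the
two-mode correlations are `c = √(μ² - 1/4)` and `-c`. -/

/-- The squared weights `N^n / (N+1)^(n+1)` of a thermal distribution. -/
def thermalWeight (N : ℝ≥0) (n : ℕ) : ℝ := (N : ℝ) ^ n / ((N : ℝ) + 1) ^ (n + 1)

theorem thermalWeight_nonneg (N : ℝ≥0) (n : ℕ) : 0 ≤ thermalWeight N n := by
  unfold thermalWeight; positivity

theorem thermalWeight_hasSum (N : ℝ≥0) : HasSum (thermalWeight N) 1 := by
  have h0 : (0 : ℝ) < (N : ℝ) + 1 := by positivity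
  have h1 : (N : ℝ) / (N + 1) < 1 := by rw [div_lt_one h0]; linarith
  have h := (hasSum_geometric_of_lt_one (by positivity) h1).mul_right (1 / ((N : ℝ) + 1))
  have e : (1 - (N : ℝ) / (N + 1))⁻¹ * (1 / ((N : ℝ) + 1)) = 1 := by
    have : 1 - (N : ℝ) / (N + 1) = 1 / (N + 1) := by field_simp; ring
    rw [this]; field_simp
  rw [e] at h
  have e' : thermalWeight N = fun n : ℕ => ((N : ℝ) / (N + 1)) ^ n * (1 / ((N : ℝ) + 1)) := by
    funext n
    rw [thermalWeight, div_pow, pow_succ, div_mul_div_comm, mul_one]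
  rw [e']
  exact h

/-- Fock amplitudes of the two-mode squeezed vacuum `∑ₙ √(N^n / (N+1)^(n+1)) |n⟩|n⟩`. -/
def tmsvAmp (N : ℝ≥0) (a b : ℕ) : ℂ := if a = b then (Real.sqrt (thermalWeight N a) : ℂ) else 0

theorem tmsvAmp_hasSum (N : ℝ≥0) : HasSum (fun p : ℕ × ℕ => ‖tmsvAmp N p.1 p.2‖ ^ 2) 1 := by
  have hinj : Function.Injective fun n : ℕ => (n, n) := fun a b h => (Prod.ext_iff.1 h).1
  refine (hinj.hasSum_iff ?_).1 ?_
  · rintro ⟨a, b⟩ h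
    have : a ≠ b := fun e => h ⟨a, by rw [e]⟩
    simp [tmsvAmp, this]
  · convert thermalWeight_hasSum N using 1
    funext n
    simp [tmsvAmp, Real.sq_sqrt (thermalWeight_nonneg N n)]

/-- Fock amplitudes `e^{-|α|²/2} αⁿ / √n!` of the coherent state. -/
def coherentAmp (α : ℂ) (n : ℕ) : ℂ :=
  (Real.exp (-‖α‖ ^ 2 / 2) : ℂ) * α ^ n / (Real.sqrt (n.factorial : ℝ) : ℂ)

theorem coherentAmp_hasSum (α : ℂ) : HasSum (fun n => ‖coherentAmp α n‖ ^ 2) 1 := by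
  have h := (NormedSpace.expSeries_div_hasSum_exp (𝔸 := ℝ) (‖α‖ ^ 2)).mul_left
    (Real.exp (-‖α‖ ^ 2))
  rw [← Real.exp_eq_exp_ℝ, ← Real.exp_add, neg_add_cancel, Real.exp_zero] at h
  have e' : (fun n => ‖coherentAmp α n‖ ^ 2) =
      fun n : ℕ => Real.exp (-‖α‖ ^ 2) * ((‖α‖ ^ 2) ^ n / (n.factorial : ℝ)) := by
    funext n
    have e : Real.exp (-‖α‖ ^ 2 / 2) ^ 2 = Real.exp (-‖α‖ ^ 2) := by
      rw [← Real.exp_nat_mul]; congr 1; push_cast; ring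
    simp only [coherentAmp, norm_div, norm_mul, norm_pow, Complex.norm_real, Real.norm_eq_abs,
      Real.abs_exp, abs_of_nonneg (Real.sqrt_nonneg _)]
    rw [div_pow, mul_pow, e, Real.sq_sqrt (by positivity)]
    ring
  rw [e']
  exact h

/-- The coherent state with amplitude `α`. -/
def coherentVec (α : ℂ) : H ℕ := ⟨coherentAmp α, memℓp_two (coherentAmp_hasSum α).summable⟩

/-- The two-mode squeezed vacuum vector. -/
def tmsvVec (N : ℝ≥0) : H (Fin 2 → ℕ) :=
  ⟨fun n => tmsvAmp N (n 0) (n 1), memℓp_two <| (tmsvAmp_hasSum N).summable.comp_injective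
    (i := fun n : Fin 2 → ℕ => (n 0, n 1)) (finTwoArrowEquiv ℕ).injective⟩

theorem summable_prod_fin {Y : Type} {f : Y → ℝ} (h0 : ∀ y, 0 ≤ f y) (hf : Summable f) (k : ℕ) :
    Summable fun g : Fin k → Y => ∏ j, f (g j) := by
  induction k with
  | zero => exact (hasSum_fintype _).summable
  | succ k ih =>
    rw [← (Fin.consEquiv fun _ => Y).summable_iff]
    refine (hf.mul_of_nonneg ih h0 fun g => Finset.prod_nonneg fun j _ => h0 _).congr ?_
    rintro ⟨y, g⟩
    simp [Fin.prod_univ_succ, Fin.consEquiv]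

theorem tmsvVec_prod_summable (N : ℝ≥0) (k : ℕ) :
    Summable fun g : Fin k → Fin 2 → ℕ => ∏ j, ‖tmsvVec N (g j)‖ ^ 2 :=
  summable_prod_fin (fun _ => by positivity) (summable_sq (tmsvVec N)) k

/-- The product of `k` two-mode squeezed vacua on `m = 2 k` modes, the `j`-th one occupying the
modes `e (j, 0)` and `e (j, 1)`. -/
def evenProbe (N : ℝ≥0) {m k : ℕ} (e : Fin k × Fin 2 ≃ Fin m) : H (Fin m → ℕ) :=
  ⟨fun n => ∏ j, tmsvVec N fun s => n (e (j, s)), by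
    refine memℓp_two (((tmsvVec_prod_summable N k).comp_injective
      (i := fun (n : Fin m → ℕ) j s => n (e (j, s))) ?_).congr fun n => ?_)
    · intro n n' h
      funext t
      have := congrFun (congrFun h (e.symm t).1) (e.symm t).2
      simpa using this
    · simp [norm_prod, Finset.prod_pow]⟩

/-- The product of `k` two-mode squeezed vacua, occupying the modes `e (j, 0)`, `e (j, 1)`, with a
coherent state in the remaining mode `e none`. -/
def hybridProbe (N : ℝ≥0) (α : ℂ) {m k : ℕ} (e : Option (Fin k × Fin 2) ≃ Fin m) :
    H (Fin m → ℕ) :=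
  ⟨fun n => (∏ j, tmsvVec N fun s => n (e (some (j, s)))) * coherentVec α (n (e none)), by
    refine memℓp_two ((((tmsvVec_prod_summable N k).mul_of_nonneg (summable_sq (coherentVec α))
      (fun g => Finset.prod_nonneg fun j _ => by positivity) (fun n => by positivity)).comp_injective
      (i := fun n : Fin m → ℕ => (fun j s => n (e (some (j, s))), n (e none))) ?_).congr fun n => ?_)
    · intro n n' h
      funext t
      obtain ⟨o, rfl⟩ := e.surjective t
      rcases o with _ | ⟨j, s⟩
      · exact (Prod.ext_iff.1 h).2
      · exact congrFun (congrFun (Prod.ext_iff.1 h).1 j) s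
    · simp [norm_prod, Finset.prod_pow, mul_pow]⟩

/-- The product of `k` two-mode squeezed vacua, occupying the modes `e (j, 0)`, `e (j, 1)`, with a
two-mode squeezed vacuum shared by the remaining mode `e none` and an idler, which is put last. -/
def idlerProbe (N : ℝ≥0) {m k : ℕ} (e : Option (Fin k × Fin 2) ≃ Fin m) :
    H (Fin (m + 1) → ℕ) :=
  ⟨fun n => (∏ j, tmsvVec N fun s => n (e (some (j, s))).castSucc) *
      tmsvVec N ![n (e none).castSucc, n (Fin.last m)], by
    refine memℓp_two ((((tmsvVec_prod_summable N k).mul_of_nonneg (summable_sq (tmsvVec N))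
      (fun g => Finset.prod_nonneg fun j _ => by positivity) (fun n => by positivity)).comp_injective
      (i := fun n : Fin (m + 1) → ℕ => (fun j s => n (e (some (j, s))).castSucc,
        ![n (e none).castSucc, n (Fin.last m)])) ?_).congr fun n => ?_)
    · intro n n' h
      funext t
      refine Fin.lastCases ?_ (fun t => ?_) t
      · exact congrFun (Prod.ext_iff.1 h).2 1
      · obtain ⟨o, rfl⟩ := e.surjective t
        rcases o with _ | ⟨j, s⟩
        · exact congrFun (Prod.ext_iff.1 h).2 0
        · exact congrFun (congrFun (Prod.ext_iff.1 h).1 j) s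
    · simp [norm_prod, Finset.prod_pow, mul_pow]⟩

/-! ### Output states, sub-fidelities and the quantity `D₂`

`E false` is the background channel and `E true` the target channel. -/

/-- The output of the pattern `i` of channels for the input vector `v`. -/
def patternOutput (E : Bool → Channel) {m : ℕ} (i : Pattern m) (v : H (Fin m → ℕ)) :
    Op (Fin m → ℕ) :=
  productChannel (fun s => E (i s)) (pureState v)

/-- The output when the pattern `i` acts on the first `m` modes and the last mode is an idler. -/
def patternOutputIdler (E : Bool → Channel) {m : ℕ} (i : Pattern m) (v : H (Fin (m + 1) → ℕ)) :
    Op (Fin (m + 1) → ℕ) :=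
  productChannel (Fin.snoc (fun s => E (i s)) Channel.id) (pureState v)

/-- The fidelity of the outputs of two patterns on a pair of channels probed by a two-mode squeezed
vacuum. -/
def pairFidelity (E : Bool → Channel) (N : ℝ≥0) (i i' : Pattern 2) : ℝ :=
  fidelity (patternOutput E i (tmsvVec N)) (patternOutput E i' (tmsvVec N))

/-- The sub-fidelity between patterns with no target and with one target. -/
def F01 (E : Bool → Channel) (N : ℝ≥0) : ℝ := pairFidelity E N ![false, false] ![false, true]

/-- The sub-fidelity between patterns with one target and with two targets. -/
def F12 (E : Bool → Channel) (N : ℝ≥0) : ℝ := pairFidelity E N ![false, true] ![true, true]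

/-- The sub-fidelity between the two patterns with one target. -/
def F11 (E : Bool → Channel) (N : ℝ≥0) : ℝ := pairFidelity E N ![true, false] ![false, true]

/-- The sub-fidelity between the patterns with no target and with two targets. -/
def F02 (E : Bool → Channel) (N : ℝ≥0) : ℝ := pairFidelity E N ![false, false] ![true, true]

/-- The number of target channels in a pattern. -/
def targets {m : ℕ} (i : Pattern m) : ℕ := (Finset.univ.filter fun s => i s = true).card

/-- The quantity `D₂[M] = 1 + F₀₁^M + F₁₂^M + (F₁₁^M + F₀₂^M) / 2`. -/
def D2 (E : Bool → Channel) (N : ℝ≥0) (M : ℕ) : ℝ :=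
  1 + F01 E N ^ M + F12 E N ^ M + (F11 E N ^ M + F02 E N ^ M) / 2

/-- The fidelity of the background and target outputs for a coherent probe of one channel. -/
def Fcl (E : Bool → Channel) (α : ℂ) : ℝ :=
  fidelity ((E false).apply (pureState (coherentVec α))) ((E true).apply (pureState (coherentVec α)))

/-- The fidelity of the finite-energy Choi states of the background and target channels. -/
def Fchoi (E : Bool → Channel) (N : ℝ≥0) : ℝ :=
  fidelity (productChannel ![E false, Channel.id] (pureState (tmsvVec N)))
    (productChannel ![E true, Channel.id] (pureState (tmsvVec N)))

end

end BosonicDiscrimination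

open BosonicDiscrimination

open scoped InnerProduct

namespace BosonicDiscrimination

noncomputable section

/-! ### Matrix elements -/

section Entries

variable {X Y Z : Type}

/-! The theorem combines two general bounds for discriminating equiprobable states `ρ i`, each of
probability `c`, with the multiplicativity of the fidelity.

Lower bound (`half_sum_fidelity_sq_le_errorProb`): for every measurement the fidelity of two states
is at most the Bhattacharyya overlap of their outcome distributions (`fidelity_le_sum_measurement`),
and for classical joint distributions half the sum of the squared overlaps bounds the error from
below (`half_sum_sq_bhattacharyya_le`). The error is therefore at least `c² ∑_{i≠j} F² / 2`.

Upper bound (`minErrorProb_le_sum_fidelity`): the square-root measurement has error at most `c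
∑_{i≠j} F`. The operator inequality behind this is `exists_contraction_two_mul_hsNormSq_le`;
`sum_hsNormSq_offDiag_le` applies it to one state against all the others.

The fidelity is multiplicative (`IsTensor.fidelity_eq`), so `M` copies turn `F` into `F^M` and `F²`
into `F^{2M}`. On a product probe the sum of `F^K` over all ordered pairs of patterns, diagonal
included, factors over the blocks of the probe (`sum_sum_split`). A block of two channels
contributes `4 D₂[K]` and a single channel contributes `2 (1 + F^K)`. Altogether this is `2^m` times
the products in the theorem. Removing the diagonal, which contributes `2^m`, and inserting `c =
2^{-m}` gives both bounds.

In infinite dimension the trace is an infinite series, so convergence has to be supplied throughout.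
The square root of a density operator is Hilbert–Schmidt, and every trace needed is that of a
product of two Hilbert–Schmidt operators. Tensor products are characterised by their matrix elements
(`IsTensor`), which determine a bounded operator, so identities between them reduce to products of
absolutely convergent series. -/

theorem ket_eq_single [DecidableEq X] (a : X) : ket a = lp.single 2 a (1 : ℂ) := by
  unfold ket
  congr!

theorem ket_apply [DecidableEq X] (a b : X) : ket a b = if b = a then 1 else 0 := by
  rw [ket_eq_single, lp.single_apply]
  by_cases h : b = a
  · subst h; simp
  · simp [h]

theorem inner_ket_left (a : X) (ψ : H X) : inner ℂ (ket a) ψ = ψ a := by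
  classical
  rw [ket_eq_single, lp.inner_single_left]
  simp

theorem inner_ket_right (a : X) (ψ : H X) : inner ℂ ψ (ket a) = star (ψ a) := by
  rw [← inner_conj_symm, inner_ket_left]; rfl

theorem hasSum_ket (ψ : H X) : HasSum (fun a => ψ a • ket a) ψ := by
  classical
  convert lp.hasSum_single (p := 2) (by norm_num) ψ using 2 with a
  rw [ket_eq_single, ← lp.single_smul]
  simp

theorem hasSum_apply (A : H X →L[ℂ] H Y) (ψ : H X) (y : Y) :
    HasSum (fun x => ψ x * A (ket x) y) (A ψ y) := by
  have h := (hasSum_ket ψ).mapL (innerSL ℂ (ket y) ∘L A)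
  simpa [inner_ket_left] using h

theorem op_ext {A B : H X →L[ℂ] H Y} (h : ∀ x y, A (ket x) y = B (ket x) y) : A = B := by
  ext ψ y
  exact (hasSum_apply A ψ y).unique (by simpa only [h] using hasSum_apply B ψ y)

theorem adjoint_entry (A : H X →L[ℂ] H Y) (x : X) (y : Y) :
    (A†) (ket y) x = star (A (ket x) y) := by
  rw [← inner_ket_left, ContinuousLinearMap.adjoint_inner_right, inner_ket_right]

theorem sum_entry {ι : Type} (s : Finset ι) (A : ι → H X →L[ℂ] H Y) (ψ : H X) (y : Y) :
    (∑ i ∈ s, A i) ψ y = ∑ i ∈ s, A i ψ y := by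
  simp only [← inner_ket_left, sum_apply, inner_sum]

theorem entry_comp (A : H Y →L[ℂ] H Z) (B : H X →L[ℂ] H Y) (x : X) (z : Z) :
    HasSum (fun y => A (ket y) z * B (ket x) y) ((A ∘L B) (ket x) z) := by
  simpa [mul_comm] using hasSum_apply A (B (ket x)) z

theorem hasSum_inner (ψ φ : H X) : HasSum (fun x => star (ψ x) * φ x) (inner ℂ ψ φ) := by
  have e : (fun x => star (ψ x) * φ x) = fun x => inner ℂ (ψ x) (φ x) :=
    funext fun x => mul_comm (star (ψ x)) (φ x)
  rw [e]
  exact lp.hasSum_inner ψ φ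

theorem summable_norm_mul (ψ φ : H X) : Summable fun x => ‖ψ x * φ x‖ := by
  refine Summable.of_nonneg_of_le (fun _ => norm_nonneg _) (fun x => ?_)
    ((summable_sq ψ).add (summable_sq φ))
  rw [norm_mul]
  nlinarith [sq_nonneg (‖ψ x‖ - ‖φ x‖), sq_nonneg (‖ψ x‖), sq_nonneg (‖φ x‖)]

theorem summable_norm_entry_mul (A : H X →L[ℂ] H Y) (ψ : H X) (y : Y) :
    Summable fun x => ‖ψ x * A (ket x) y‖ := by
  refine (summable_norm_mul ψ ((A†) (ket y))).congr fun x => ?_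
  simp [adjoint_entry]

end Entries

/-! ### Hilbert–Schmidt operators and the trace -/

section HilbertSchmidt

variable {X Y Z : Type}

/-- Hilbert–Schmidt operators. -/
def HilbertSchmidt (A : H X →L[ℂ] H Y) : Prop := Summable fun x => ‖A (ket x)‖ ^ 2

/-- The square of the Hilbert–Schmidt norm. -/
def hsNormSq (A : H X →L[ℂ] H Y) : ℝ := ∑' x, ‖A (ket x)‖ ^ 2

theorem hsNormSq_nonneg (A : H X →L[ℂ] H Y) : 0 ≤ hsNormSq A :=
  tsum_nonneg fun _ => by positivity

theorem HilbertSchmidt.summable_entries {A : H X →L[ℂ] H Y} (hA : HilbertSchmidt A) :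
    Summable fun p : X × Y => ‖A (ket p.1) p.2‖ ^ 2 := by
  refine (summable_prod_of_nonneg fun p => by positivity).2 ⟨fun x => summable_sq (A (ket x)), ?_⟩
  exact hA.congr fun x => (hasSum_norm_sq (A (ket x))).tsum_eq.symm

theorem HilbertSchmidt.adjoint {A : H X →L[ℂ] H Y} (hA : HilbertSchmidt A) :
    HilbertSchmidt (A†) := by
  have h := ((Equiv.prodComm Y X).summable_iff.2 hA.summable_entries)
  have h2 := ((summable_prod_of_nonneg (fun p => sq_nonneg _)).1 h).2
  refine h2.congr fun y => ?_
  rw [← (hasSum_norm_sq _).tsum_eq]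
  simp [adjoint_entry]

theorem hsNormSq_adjoint {A : H X →L[ℂ] H Y} (hA : HilbertSchmidt A) :
    hsNormSq (A†) = hsNormSq A := by
  have h := hA.summable_entries
  have e1 : ∀ y, ‖(A†) (ket y)‖ ^ 2 = ∑' x, ‖A (ket x) y‖ ^ 2 := fun y => by
    rw [← (hasSum_norm_sq _).tsum_eq]; simp [adjoint_entry]
  have e2 : ∀ x, ‖A (ket x)‖ ^ 2 = ∑' y, ‖A (ket x) y‖ ^ 2 := fun x =>
    (hasSum_norm_sq _).tsum_eq.symm
  rw [hsNormSq, hsNormSq, tsum_congr e1, tsum_congr e2]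
  exact Summable.tsum_comm h

theorem HilbertSchmidt.comp_left {A : H X →L[ℂ] H Y} (hA : HilbertSchmidt A)
    (C : H Y →L[ℂ] H Z) : HilbertSchmidt (C ∘L A) := by
  refine Summable.of_nonneg_of_le (fun _ => by positivity) (fun x => ?_) (hA.mul_left (‖C‖ ^ 2))
  rw [← mul_pow]
  exact pow_le_pow_left₀ (norm_nonneg _) (C.le_opNorm _) 2

theorem HilbertSchmidt.comp_right {A : H Y →L[ℂ] H Z} (hA : HilbertSchmidt A)
    (C : H X →L[ℂ] H Y) : HilbertSchmidt (A ∘L C) := by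
  have := (hA.adjoint.comp_left (C†)).adjoint
  simpa [ContinuousLinearMap.adjoint_comp] using this

theorem hsNormSq_comp_left_le {A : H X →L[ℂ] H Y} (hA : HilbertSchmidt A)
    {C : H Y →L[ℂ] H Z} (hC : ‖C‖ ≤ 1) : hsNormSq (C ∘L A) ≤ hsNormSq A := by
  refine (hA.comp_left C).tsum_le_tsum (fun x => ?_) hA
  exact pow_le_pow_left₀ (norm_nonneg _) (C.le_of_opNorm_le hC _ |>.trans (by simp)) 2

theorem norm_adjoint_le {C : H X →L[ℂ] H Y} (hC : ‖C‖ ≤ 1) : ‖C†‖ ≤ 1 := by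
  simpa using hC

theorem hsNormSq_comp_right_le {A : H Y →L[ℂ] H Z} (hA : HilbertSchmidt A)
    {C : H X →L[ℂ] H Y} (hC : ‖C‖ ≤ 1) : hsNormSq (A ∘L C) ≤ hsNormSq A := by
  rw [← hsNormSq_adjoint (hA.comp_right C), ← hsNormSq_adjoint hA, ContinuousLinearMap.adjoint_comp]
  exact hsNormSq_comp_left_le hA.adjoint (norm_adjoint_le hC)

theorem HilbertSchmidt.add {A B : H X →L[ℂ] H Y} (hA : HilbertSchmidt A)
    (hB : HilbertSchmidt B) : HilbertSchmidt (A + B) := by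
  refine Summable.of_nonneg_of_le (fun _ => by positivity) (fun x => ?_)
    ((Summable.mul_left 2 hA).add (Summable.mul_left 2 hB))
  have := norm_add_le (A (ket x)) (B (ket x))
  simp only [add_apply]
  nlinarith [sq_nonneg (‖A (ket x)‖ - ‖B (ket x)‖), norm_nonneg (A (ket x) + B (ket x))]

theorem HilbertSchmidt.sum {ι : Type} (s : Finset ι) {A : ι → H X →L[ℂ] H Y}
    (hA : ∀ i ∈ s, HilbertSchmidt (A i)) : HilbertSchmidt (∑ i ∈ s, A i) := by
  classical
  induction s using Finset.induction_on with
  | empty => simp [HilbertSchmidt, summable_zero]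
  | insert i s hi ih =>
    rw [Finset.sum_insert hi]
    exact (hA i (by simp)).add (ih fun j hj => hA j (by simp [hj]))

theorem tr_eq (A : Op X) : tr A = ∑' x, A (ket x) x := by
  simp only [tr, inner_ket_left]

theorem tr_adjoint (A : Op X) : tr (A†) = star (tr A) := by
  rw [tr_eq, tr_eq, tsum_star]
  simp only [adjoint_entry]

/-- The operators with an absolutely convergent diagonal. -/
def DiagSummable (A : Op X) : Prop := Summable fun x => A (ket x) x

theorem DiagSummable.add {A B : Op X} (hA : DiagSummable A) (hB : DiagSummable B) :
    DiagSummable (A + B) := by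
  simpa [DiagSummable] using Summable.add hA hB

theorem tr_add {A B : Op X} (hA : DiagSummable A) (hB : DiagSummable B) :
    tr (A + B) = tr A + tr B := by
  simpa [tr_eq] using Summable.tsum_add hA hB

theorem tr_neg (A : Op X) : tr (-A) = -tr A := by
  simp [tr_eq, tsum_neg]

theorem tr_sum {ι : Type} (s : Finset ι) {A : ι → Op X} (hA : ∀ i ∈ s, DiagSummable (A i)) :
    tr (∑ i ∈ s, A i) = ∑ i ∈ s, tr (A i) := by
  simpa only [tr_eq, sum_entry] using Summable.tsum_finsetSum hA

theorem adjoint_comp_entry (A B : H X →L[ℂ] H Y) (x : X) :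
    (A† ∘L B) (ket x) x = inner ℂ (A (ket x)) (B (ket x)) := by
  rw [← inner_ket_left, ContinuousLinearMap.comp_apply, ContinuousLinearMap.adjoint_inner_right]

theorem diagSummable_norm_adjoint_comp {A B : H X →L[ℂ] H Y} (hA : HilbertSchmidt A)
    (hB : HilbertSchmidt B) : Summable fun x => ‖A (ket x)‖ * ‖B (ket x)‖ := by
  refine Summable.of_nonneg_of_le (fun _ => by positivity) (fun x => ?_) (Summable.add hA hB)
  nlinarith [sq_nonneg (‖A (ket x)‖ - ‖B (ket x)‖), sq_nonneg (‖A (ket x)‖),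
    sq_nonneg (‖B (ket x)‖)]

theorem diagSummable_adjoint_comp {A B : H X →L[ℂ] H Y} (hA : HilbertSchmidt A)
    (hB : HilbertSchmidt B) : DiagSummable (A† ∘L B) := by
  refine Summable.of_norm_bounded (diagSummable_norm_adjoint_comp hA hB) fun x => ?_
  rw [adjoint_comp_entry]
  exact norm_inner_le_norm _ _

theorem diagSummable_comp {A : H Y →L[ℂ] H X} {B : H X →L[ℂ] H Y} (hA : HilbertSchmidt A)
    (hB : HilbertSchmidt B) : DiagSummable (A ∘L B) := by
  simpa using diagSummable_adjoint_comp hA.adjoint hB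

/-- Cauchy–Schwarz twice: inside each column, then over the columns. -/
theorem norm_tr_adjoint_comp_le {A B : H X →L[ℂ] H Y} (hA : HilbertSchmidt A)
    (hB : HilbertSchmidt B) : ‖tr (A† ∘L B)‖ ≤ √(hsNormSq A) * √(hsNormSq B) := by
  rw [tr_eq]
  have h1 : ‖∑' x, (A† ∘L B) (ket x) x‖ ≤ ∑' x, ‖A (ket x)‖ * ‖B (ket x)‖ := by
    refine tsum_of_norm_bounded (diagSummable_norm_adjoint_comp hA hB).hasSum fun x => ?_
    rw [adjoint_comp_entry]
    exact norm_inner_le_norm _ _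
  refine h1.trans ?_
  have h2 := Real.inner_le_Lp_mul_Lq_tsum_of_nonneg (p := 2) (q := 2) (f := fun x => ‖A (ket x)‖)
    (g := fun x => ‖B (ket x)‖) Real.HolderConjugate.two_two (fun _ => norm_nonneg _)
    (fun _ => norm_nonneg _) (by simpa [HilbertSchmidt] using hA)
    (by simpa [HilbertSchmidt] using hB)
  simpa [hsNormSq, Real.sqrt_eq_rpow] using h2

theorem tr_adjoint_comp_self (A : H X →L[ℂ] H Y) :
    tr (A† ∘L A) = (hsNormSq A : ℂ) := by
  rw [tr_eq, hsNormSq, Complex.ofReal_tsum]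
  refine tsum_congr fun x => ?_
  rw [adjoint_comp_entry, inner_self_eq_norm_sq_to_K]
  simp

/-- Both traces are iterated sums of the same double series, which converges absolutely since `|ab|
≤ |a|² + |b|²`. -/
theorem tr_comp_comm {A : H Y →L[ℂ] H X} {B : H X →L[ℂ] H Y} (hA : HilbertSchmidt A)
    (hB : HilbertSchmidt B) : tr (A ∘L B) = tr (B ∘L A) := by
  have e1 : ∀ x, (A ∘L B) (ket x) x = ∑' y, A (ket y) x * B (ket x) y := fun x =>
    (entry_comp A B x x).tsum_eq.symm
  have e2 : ∀ y, (B ∘L A) (ket y) y = ∑' x, A (ket y) x * B (ket x) y := fun y => by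
    rw [← (entry_comp B A y y).tsum_eq]
    simp [mul_comm]
  rw [tr_eq, tr_eq, tsum_congr e1, tsum_congr e2]
  refine (Summable.tsum_comm (f := fun x y => A (ket y) x * B (ket x) y) ?_).symm
  refine Summable.of_norm_bounded
    (((Equiv.prodComm X Y).summable_iff.2 hA.summable_entries).add hB.summable_entries) fun p => ?_
  rw [Function.uncurry, norm_mul]
  simp only [Function.comp, Equiv.prodComm_apply, Prod.fst_swap, Prod.snd_swap]
  nlinarith [sq_nonneg (‖A (ket p.2) p.1‖ - ‖B (ket p.1) p.2‖), sq_nonneg (‖A (ket p.2) p.1‖),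
    sq_nonneg (‖B (ket p.1) p.2‖)]

end HilbertSchmidt

/-! ### Square roots and the polar decomposition -/

section Polar

variable {V W : Type} [NormedAddCommGroup V] [InnerProductSpace ℂ V] [CompleteSpace V]
  [NormedAddCommGroup W] [InnerProductSpace ℂ W] [CompleteSpace W]

theorem opSqrt_nonneg (A : V →L[ℂ] V) : 0 ≤ opSqrt A := CFC.sqrt_nonneg A

theorem opSqrt_comp_self {A : V →L[ℂ] V} (hA : 0 ≤ A) : opSqrt A ∘L opSqrt A = A :=
  CFC.sqrt_mul_sqrt_self A hA

theorem opSqrt_unique {A B : V →L[ℂ] V} (h : B ∘L B = A) (hB : 0 ≤ B) : opSqrt A = B :=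
  CFC.sqrt_unique h hB

theorem adjoint_of_nonneg {A : V →L[ℂ] V} (hA : 0 ≤ A) : A† = A :=
  (ContinuousLinearMap.nonneg_iff_isPositive A).1 hA |>.isSelfAdjoint

@[simp] theorem adjoint_opSqrt (A : V →L[ℂ] V) : (opSqrt A)† = opSqrt A :=
  adjoint_of_nonneg (opSqrt_nonneg A)

theorem adjoint_comp_self_nonneg (A : V →L[ℂ] W) : 0 ≤ A† ∘L A :=
  (ContinuousLinearMap.nonneg_iff_isPositive _).2 A.isPositive_adjoint_comp_self

/-- The absolute value `√(T† T)`. -/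
def opAbs (T : V →L[ℂ] W) : V →L[ℂ] V := opSqrt (T† ∘L T)

theorem opAbs_nonneg (T : V →L[ℂ] W) : 0 ≤ opAbs T := opSqrt_nonneg _

theorem opAbs_comp_self (T : V →L[ℂ] W) : opAbs T ∘L opAbs T = T† ∘L T :=
  opSqrt_comp_self (adjoint_comp_self_nonneg T)

theorem norm_opAbs_apply (T : V →L[ℂ] W) (x : V) : ‖opAbs T x‖ = ‖T x‖ := by
  have h : inner ℂ (opAbs T x) (opAbs T x) = inner ℂ (T x) (T x) := by
    rw [← ContinuousLinearMap.adjoint_inner_right, adjoint_of_nonneg (opAbs_nonneg T),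
      ← ContinuousLinearMap.comp_apply, opAbs_comp_self, ContinuousLinearMap.comp_apply,
      ContinuousLinearMap.adjoint_inner_right]
  rw [inner_self_eq_norm_sq_to_K, inner_self_eq_norm_sq_to_K] at h
  have h' : ‖opAbs T x‖ ^ 2 = ‖T x‖ ^ 2 := by exact_mod_cast h
  exact (pow_left_inj₀ (norm_nonneg _) (norm_nonneg _) two_ne_zero).1 h'

/-- The map `|T| x ↦ T x` is well defined and isometric on the range of `|T|`, because the two norms
agree. It extends by continuity to the closure and by zero to the orthogonal complement. -/
theorem exists_polar (T : V →L[ℂ] W) :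
    ∃ U : V →L[ℂ] W, ‖U‖ ≤ 1 ∧ U ∘L opAbs T = T ∧ U† ∘L T = opAbs T := by
  set P := opAbs T with hP
  set K := P.range.topologicalClosure with hK
  have hmem : ∀ x, P x ∈ K := fun x => P.range.le_topologicalClosure ⟨x, rfl⟩
  let e : V →ₗ[ℂ] K := P.toLinearMap.codRestrict K hmem
  have hdense : DenseRange e := by
    rintro ⟨y, hy⟩
    rw [closure_subtype]
    have : (Subtype.val '' Set.range e : Set V) = P.range := by
      ext z
      simp [e]
    rw [this]
    exact hy
  have hn : ∀ x, ‖T.toLinearMap x‖ ≤ 1 * ‖e x‖ := fun x => by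
    rw [one_mul]
    exact (norm_opAbs_apply T x).ge
  let U : V →L[ℂ] W := (T.toLinearMap.extendOfNorm e) ∘L K.orthogonalProjectionOnto
  have hU : ‖U‖ ≤ 1 := by
    refine U.opNorm_le_bound zero_le_one fun x => ?_
    refine (LinearMap.norm_extendOfNorm_apply_le hdense 1 hn _).trans ?_
    rw [one_mul, one_mul]
    exact K.norm_orthogonalProjectionOnto_apply_le x
  have hUP : ∀ x, U (P x) = T x := fun x => by
    have h1 : K.orthogonalProjectionOnto (P x) = e x :=
      K.orthogonalProjectionOnto_mem_subspace_eq_self (e x)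
    change T.toLinearMap.extendOfNorm e (K.orthogonalProjectionOnto (P x)) = T x
    rw [h1, LinearMap.extendOfNorm_eq hdense ⟨1, hn⟩]
    rfl
  refine ⟨U, hU, ContinuousLinearMap.ext hUP, ContinuousLinearMap.ext fun x => ?_⟩
  -- No description of `U† U` is needed: expanding `‖U† T x - |T| x‖²` gives at most `‖T x‖² - 2 ‖T
  -- x‖² + ‖T x‖² = 0`.
  have h1 : ‖(U†) (T x)‖ ≤ ‖T x‖ := by
    simpa using (U†).le_of_opNorm_le (c := 1) (by simpa using hU) (T x)
  have h2 : RCLike.re (inner ℂ ((U†) (T x)) (P x)) = ‖T x‖ ^ 2 := by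
    rw [ContinuousLinearMap.adjoint_inner_left, hUP, inner_self_eq_norm_sq]
  have h3 := norm_sub_sq (𝕜 := ℂ) ((U†) (T x)) (P x)
  rw [h2, norm_opAbs_apply] at h3
  have h4 : ‖(U†) (T x) - P x‖ ^ 2 ≤ 0 := by
    nlinarith [norm_nonneg ((U†) (T x)), norm_nonneg (T x)]
  have h5 := pow_eq_zero_iff two_ne_zero |>.1 (le_antisymm h4 (by positivity))
  exact sub_eq_zero.1 (norm_eq_zero.1 h5)

end Polar

/-! ### The trace norm -/

section TraceNorm

variable {X Y Z : Type}

theorem nonneg_entry {A : Op X} (hA : 0 ≤ A) (x : X) :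
    A (ket x) x = ((‖opSqrt A (ket x)‖ ^ 2 : ℝ) : ℂ) := by
  conv_lhs => rw [← opSqrt_comp_self hA]
  have := adjoint_comp_entry (opSqrt A) (opSqrt A) x
  rw [adjoint_opSqrt, inner_self_eq_norm_sq_to_K] at this
  simpa using this

theorem hilbertSchmidt_opSqrt {A : Op X} (hA : 0 ≤ A) (h : DiagSummable A) :
    HilbertSchmidt (opSqrt A) := by
  have h' : Summable fun x => ((‖opSqrt A (ket x)‖ ^ 2 : ℝ) : ℂ) := by
    simpa only [DiagSummable, nonneg_entry hA] using h
  exact_mod_cast h'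

theorem tr_eq_hsNormSq {A : Op X} (hA : 0 ≤ A) : tr A = (hsNormSq (opSqrt A) : ℂ) := by
  rw [← tr_adjoint_comp_self, adjoint_opSqrt, opSqrt_comp_self hA]

theorem tr_re_nonneg {A : Op X} (hA : 0 ≤ A) : 0 ≤ (tr A).re := by
  rw [tr_eq_hsNormSq hA, Complex.ofReal_re]
  exact hsNormSq_nonneg _

/-- The trace norm `Tr √(T† T)`. -/
def traceNorm (T : H X →L[ℂ] H Y) : ℝ := (tr (opAbs T)).re

theorem traceNorm_eq_tr (T : H X →L[ℂ] H Y) : (traceNorm T : ℂ) = tr (opAbs T) := by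
  rw [traceNorm, tr_eq_hsNormSq (opAbs_nonneg T), Complex.ofReal_re]

theorem traceNorm_nonneg (T : H X →L[ℂ] H Y) : 0 ≤ traceNorm T := tr_re_nonneg (opAbs_nonneg T)

theorem exists_contraction_tr_eq (T : H X →L[ℂ] H Y) :
    ∃ U : H X →L[ℂ] H Y, ‖U‖ ≤ 1 ∧ tr (U† ∘L T) = traceNorm T := by
  obtain ⟨U, hU, -, h⟩ := exists_polar T
  exact ⟨U, hU, by rw [h, traceNorm_eq_tr]⟩

theorem diagSummable_opAbs {A : H Y →L[ℂ] H Z} {B : H X →L[ℂ] H Y} (hA : HilbertSchmidt A)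
    (hB : HilbertSchmidt B) : DiagSummable (opAbs (A ∘L B)) := by
  obtain ⟨U, -, -, h⟩ := exists_polar (A ∘L B)
  rw [← h, ← ContinuousLinearMap.comp_assoc]
  exact diagSummable_comp (hA.comp_left _) hB

/-- With `T = A B = U S S` and `S = √|T|`, the operator `C T` is the product of `C U S` and `S`.
Cauchy–Schwarz bounds its trace by the squared Hilbert–Schmidt norm of `S`, which is `Tr |T|`. The
factorisation of `T` ensures that this trace converges. -/
theorem norm_tr_comp_le_traceNorm {A : H Y →L[ℂ] H Z} {B : H X →L[ℂ] H Y}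
    (hA : HilbertSchmidt A) (hB : HilbertSchmidt B) {C : H Z →L[ℂ] H X} (hC : ‖C‖ ≤ 1) :
    ‖tr (C ∘L A ∘L B)‖ ≤ traceNorm (A ∘L B) := by
  obtain ⟨U, hU, hUT, -⟩ := exists_polar (A ∘L B)
  set S := opSqrt (opAbs (A ∘L B)) with hS
  have hSS : HilbertSchmidt S :=
    hilbertSchmidt_opSqrt (opAbs_nonneg _) (diagSummable_opAbs hA hB)
  have hCU : ‖C ∘L U‖ ≤ 1 :=
    (C.opNorm_comp_le U).trans (mul_le_one₀ hC (norm_nonneg _) hU)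
  have h1 : C ∘L A ∘L B = ((C ∘L U ∘L S)†)† ∘L S := by
    rw [ContinuousLinearMap.adjoint_adjoint]
    conv_lhs => rw [← hUT, ← opSqrt_comp_self (opAbs_nonneg (A ∘L B))]
    simp only [ContinuousLinearMap.comp_assoc, hS]
  have hCUS : HilbertSchmidt (C ∘L U ∘L S) := hSS.comp_left (C ∘L U)
  have hle : hsNormSq (C ∘L U ∘L S) ≤ hsNormSq S := by
    rw [← ContinuousLinearMap.comp_assoc]
    exact hsNormSq_comp_left_le hSS hCU
  rw [h1]
  refine (norm_tr_adjoint_comp_le hCUS.adjoint hSS).trans ?_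
  rw [hsNormSq_adjoint hCUS, traceNorm, tr_eq_hsNormSq (opAbs_nonneg _), Complex.ofReal_re, ← hS]
  calc √(hsNormSq (C ∘L U ∘L S)) * √(hsNormSq S) ≤ √(hsNormSq S) * √(hsNormSq S) := by
        gcongr
    _ = hsNormSq S := Real.mul_self_sqrt (hsNormSq_nonneg _)

/-- The trace norm of `T` is attained as `Tr U† T`. Conjugating and using cyclicity rewrites it as
`Tr U T†`, which the trace norm of `T†` dominates. Applied in both directions it yields the symmetry
of the fidelity. -/
theorem traceNorm_adjoint_le {A : H Y →L[ℂ] H Z} {B : H X →L[ℂ] H Y} (hA : HilbertSchmidt A)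
    (hB : HilbertSchmidt B) : traceNorm (A ∘L B) ≤ traceNorm (B† ∘L A†) := by
  obtain ⟨U, hU, h⟩ := exists_contraction_tr_eq (A ∘L B)
  have h1 : ‖tr (U ∘L B† ∘L A†)‖ ≤ traceNorm (B† ∘L A†) :=
    norm_tr_comp_le_traceNorm hB.adjoint hA.adjoint hU
  have h2 : tr (U ∘L B† ∘L A†) = traceNorm (A ∘L B) := by
    have h3 : tr (U ∘L B† ∘L A†) = tr (B† ∘L A† ∘L U) := by
      have := tr_comp_comm (hB.adjoint.comp_left U) hA.adjoint
      have h4 := tr_comp_comm hB.adjoint (hA.adjoint.comp_right U)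
      simp only [ContinuousLinearMap.comp_assoc] at this h4
      rw [h4, this]
    have h4 : (B† ∘L A† ∘L U) = (U† ∘L A ∘L B)† := by
      simp [ContinuousLinearMap.adjoint_comp, ContinuousLinearMap.comp_assoc]
    rw [h3, h4, tr_adjoint, h]
    simp
  rw [h2] at h1
  simpa [abs_of_nonneg (traceNorm_nonneg _)] using h1

end TraceNorm

/-! ### States and their fidelity -/

section Fidelity

variable {X Y Z : Type}

/-- Density operators: positive operators of trace one. -/
structure IsDensity (ρ : Op X) : Prop where
  nonneg : 0 ≤ ρ
  hasSum : HasSum (fun x => ρ (ket x) x) 1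

theorem IsDensity.tr_eq_one {ρ : Op X} (h : IsDensity ρ) : tr ρ = 1 := by
  rw [tr_eq, h.hasSum.tsum_eq]

theorem IsDensity.hilbertSchmidt {ρ : Op X} (h : IsDensity ρ) : HilbertSchmidt (opSqrt ρ) :=
  hilbertSchmidt_opSqrt h.nonneg h.hasSum.summable

theorem fidelity_eq_traceNorm (ρ : Op X) {σ : Op X} (hσ : 0 ≤ σ) :
    fidelity ρ σ = traceNorm (opSqrt σ ∘L opSqrt ρ) := by
  have : opSqrt ρ * σ * opSqrt ρ = (opSqrt σ ∘L opSqrt ρ)† ∘L (opSqrt σ ∘L opSqrt ρ) := by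
    conv_lhs => rw [← opSqrt_comp_self hσ]
    simp only [ContinuousLinearMap.adjoint_comp, adjoint_opSqrt]
    rfl
  rw [fidelity, this]
  rfl

theorem fidelity_nonneg (ρ σ : Op X) : 0 ≤ fidelity ρ σ := tr_re_nonneg (opSqrt_nonneg _)

theorem fidelity_comm {ρ σ : Op X} (hρ : IsDensity ρ) (hσ : IsDensity σ) :
    fidelity ρ σ = fidelity σ ρ := by
  rw [fidelity_eq_traceNorm ρ hσ.nonneg, fidelity_eq_traceNorm σ hρ.nonneg]
  have h1 := traceNorm_adjoint_le hσ.hilbertSchmidt hρ.hilbertSchmidt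
  have h2 := traceNorm_adjoint_le hρ.hilbertSchmidt hσ.hilbertSchmidt
  simp only [adjoint_opSqrt] at h1 h2
  exact le_antisymm h1 h2

theorem fidelity_self {ρ : Op X} (hρ : IsDensity ρ) : fidelity ρ ρ = 1 := by
  have : opSqrt (opSqrt ρ * ρ * opSqrt ρ) = ρ := by
    refine opSqrt_unique ?_ hρ.nonneg
    have h : opSqrt ρ * opSqrt ρ = ρ := opSqrt_comp_self hρ.nonneg
    calc ρ * ρ = (opSqrt ρ * opSqrt ρ) * (opSqrt ρ * opSqrt ρ) := by rw [h]
      _ = opSqrt ρ * (opSqrt ρ * opSqrt ρ) * opSqrt ρ := by simp only [mul_assoc]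
      _ = _ := by rw [h]
  rw [fidelity, this, hρ.tr_eq_one, Complex.one_re]

end Fidelity

/-! ### A lower bound on the error probability -/

section LowerBound

variable {X I : Type}

theorem hsNormSq_opSqrt_comp {A ρ : Op X} (hA : 0 ≤ A) (hρ : IsDensity ρ) :
    hsNormSq (opSqrt A ∘L opSqrt ρ) = (tr (A * ρ)).re := by
  have h1 := tr_adjoint_comp_self (opSqrt A ∘L opSqrt ρ)
  have h2 := tr_comp_comm hρ.hilbertSchmidt (hρ.hilbertSchmidt.comp_left A)
  have h3 : (opSqrt A ∘L opSqrt ρ)† ∘L (opSqrt A ∘L opSqrt ρ) = opSqrt ρ ∘L (A ∘L opSqrt ρ) := by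
    conv_rhs => rw [← opSqrt_comp_self hA]
    simp only [ContinuousLinearMap.adjoint_comp, adjoint_opSqrt, ContinuousLinearMap.comp_assoc]
  have h4 : (A ∘L opSqrt ρ) ∘L opSqrt ρ = A * ρ := by
    rw [ContinuousLinearMap.comp_assoc, opSqrt_comp_self hρ.nonneg]
    rfl
  rw [h3, h2, h4] at h1
  rw [h1, Complex.ofReal_re]

theorem tr_mul_re_nonneg {A ρ : Op X} (hA : 0 ≤ A) (hρ : IsDensity ρ) : 0 ≤ (tr (A * ρ)).re := by
  rw [← hsNormSq_opSqrt_comp hA hρ]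
  exact hsNormSq_nonneg _

/-- Write the fidelity as `Tr U† √σ √ρ`, insert `∑ Pₖ = 1` between the roots, split each `Pₖ` into
its square roots and apply Cauchy–Schwarz outcome by outcome. -/
theorem fidelity_le_sum_measurement [Fintype I] (P : POVM I X) {ρ σ : Op X} (hρ : IsDensity ρ)
    (hσ : IsDensity σ) :
    fidelity ρ σ ≤ ∑ k, √((tr (P.effect k * ρ)).re) * √((tr (P.effect k * σ)).re) := by
  rw [fidelity_eq_traceNorm ρ hσ.nonneg]
  obtain ⟨U, hU, h⟩ := exists_contraction_tr_eq (opSqrt σ ∘L opSqrt ρ)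
  have hk : ∀ k, HilbertSchmidt (opSqrt (P.effect k) ∘L opSqrt σ ∘L U) := fun k =>
    (hσ.hilbertSchmidt.comp_right U).comp_left _
  have hk' : ∀ k, HilbertSchmidt (opSqrt (P.effect k) ∘L opSqrt ρ) := fun k =>
    hρ.hilbertSchmidt.comp_left _
  have e : U† ∘L opSqrt σ ∘L opSqrt ρ = ∑ k, (opSqrt (P.effect k) ∘L opSqrt σ ∘L U)† ∘L
      (opSqrt (P.effect k) ∘L opSqrt ρ) := by
    have h1 : ∀ k, (opSqrt (P.effect k) ∘L opSqrt σ ∘L U)† ∘L (opSqrt (P.effect k) ∘L opSqrt ρ) =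
        U† ∘L opSqrt σ ∘L P.effect k ∘L opSqrt ρ := fun k => by
      conv_rhs => rw [← opSqrt_comp_self (P.nonneg k)]
      simp only [ContinuousLinearMap.adjoint_comp, adjoint_opSqrt, ContinuousLinearMap.comp_assoc]
    simp only [h1, ← ContinuousLinearMap.comp_finsetSum, ← ContinuousLinearMap.finsetSum_comp]
    rw [P.sum_eq_one]
    rfl
  have h2 : (traceNorm (opSqrt σ ∘L opSqrt ρ) : ℂ) =
      ∑ k, tr ((opSqrt (P.effect k) ∘L opSqrt σ ∘L U)† ∘L (opSqrt (P.effect k) ∘L opSqrt ρ)) := by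
    rw [← h, e, tr_sum _ fun k _ => diagSummable_adjoint_comp (hk k) (hk' k)]
  have h3 : traceNorm (opSqrt σ ∘L opSqrt ρ) = ‖(traceNorm (opSqrt σ ∘L opSqrt ρ) : ℂ)‖ := by
    rw [Complex.norm_real, Real.norm_of_nonneg (traceNorm_nonneg _)]
  rw [h3, h2]
  refine (norm_sum_le _ _).trans (Finset.sum_le_sum fun k _ => ?_)
  refine (norm_tr_adjoint_comp_le (hk k) (hk' k)).trans ?_
  rw [← hsNormSq_opSqrt_comp (P.nonneg k) hρ, ← hsNormSq_opSqrt_comp (P.nonneg k) hσ, mul_comm]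
  have hle : hsNormSq (opSqrt (P.effect k) ∘L opSqrt σ ∘L U) ≤
      hsNormSq (opSqrt (P.effect k) ∘L opSqrt σ) := by
    rw [← ContinuousLinearMap.comp_assoc]
    exact hsNormSq_comp_right_le (hσ.hilbertSchmidt.comp_left _) hU
  gcongr

/-- With `s` the total weight, the left side is `(s² - ∑ qᵢ²) / s`, hence at most `(s - qₖ)(s + qₖ)
/ s ≤ 2 (s - qₖ)`. -/
theorem sum_offDiag_mul_div_le [Fintype I] [DecidableEq I] {q : I → ℝ} (hq : ∀ i, 0 ≤ q i) (k : I) :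
    ∑ i, ∑ j ∈ Finset.univ.filter (fun j => j ≠ i), q i * q j / ∑ l, q l ≤
      2 * ∑ i ∈ Finset.univ.filter (fun i => i ≠ k), q i := by
  set s := ∑ l, q l with hs
  have hs0 : 0 ≤ s := Finset.sum_nonneg fun i _ => hq i
  have hoff : ∀ i, ∑ j ∈ Finset.univ.filter (fun j => j ≠ i), q j = s - q i := fun i => by
    rw [hs, Finset.filter_ne', ← Finset.add_sum_erase _ _ (Finset.mem_univ i)]
    ring
  have h1 : ∑ i, ∑ j ∈ Finset.univ.filter (fun j => j ≠ i), q i * q j / s =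
      (s ^ 2 - ∑ i, q i ^ 2) / s := by
    have : ∀ i, ∑ j ∈ Finset.univ.filter (fun j => j ≠ i), q i * q j / s =
        (q i * s - q i ^ 2) / s := fun i => by
      rw [← Finset.sum_div, ← Finset.mul_sum, hoff]
      ring
    rw [Finset.sum_congr rfl fun i _ => this i, ← Finset.sum_div, Finset.sum_sub_distrib,
      ← Finset.sum_mul, ← hs, sq]
  have hk : q k ^ 2 ≤ ∑ i, q i ^ 2 :=
    Finset.single_le_sum (f := fun i => q i ^ 2) (fun i _ => sq_nonneg _) (Finset.mem_univ k)
  have hks : q k ≤ s := Finset.single_le_sum (fun i _ => hq i) (Finset.mem_univ k)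
  rw [h1, hoff]
  rcases hs0.eq_or_lt with h | h
  · rw [← h, div_zero]
    linarith [hq k]
  · rw [div_le_iff₀ h]
    nlinarith [hq k]

/-- Here `q i k` is the joint probability of hypothesis `i` and outcome `k`, and outcome `k` is
decoded as hypothesis `k`. -/
theorem half_sum_sq_bhattacharyya_le [Fintype I] [DecidableEq I] {q : I → I → ℝ}
    (hq : ∀ i k, 0 ≤ q i k) (hsum : ∑ i, ∑ k, q i k = 1) :
    (∑ i, ∑ j ∈ Finset.univ.filter (fun j => j ≠ i), (∑ k, √(q i k) * √(q j k)) ^ 2) / 2 ≤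
      ∑ i, ∑ k ∈ Finset.univ.filter (fun k => k ≠ i), q i k := by
  -- Cauchy–Schwarz weighted by the outcome probabilities `∑ l, q l k`, whose total is one. It
  -- decouples the outcomes, so that each column can be treated on its own.
  have h1 : ∀ i j, (∑ k, √(q i k) * √(q j k)) ^ 2 ≤ ∑ k, q i k * q j k / ∑ l, q l k := by
    intro i j
    have h := Finset.sum_sq_le_sum_mul_sum_of_sq_le_mul Finset.univ
      (r := fun k => √(q i k) * √(q j k)) (f := fun k => ∑ l, q l k)
      (g := fun k => q i k * q j k / ∑ l, q l k)
      (fun k _ => Finset.sum_nonneg fun l _ => hq l k)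
      (fun k _ => div_nonneg (mul_nonneg (hq i k) (hq j k)) (Finset.sum_nonneg fun l _ => hq l k))
      (fun k _ => ?_)
    · rwa [Finset.sum_comm, hsum, one_mul] at h
    · rw [mul_pow, Real.sq_sqrt (hq i k), Real.sq_sqrt (hq j k)]
      by_cases h0 : ∑ l, q l k = 0
      · have := (Finset.sum_eq_zero_iff_of_nonneg fun l _ => hq l k).1 h0 i (Finset.mem_univ i)
        simp [this]
      · rw [mul_div_cancel₀ _ h0]
  have h2 : ∑ i, ∑ j ∈ Finset.univ.filter (fun j => j ≠ i), (∑ k, √(q i k) * √(q j k)) ^ 2 ≤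
      ∑ i, ∑ j ∈ Finset.univ.filter (fun j => j ≠ i), ∑ k, q i k * q j k / ∑ l, q l k :=
    Finset.sum_le_sum fun i _ => Finset.sum_le_sum fun j _ => h1 i j
  have h3 : ∑ i, ∑ j ∈ Finset.univ.filter (fun j => j ≠ i), ∑ k, q i k * q j k / ∑ l, q l k =
      ∑ k, ∑ i, ∑ j ∈ Finset.univ.filter (fun j => j ≠ i), q i k * q j k / ∑ l, q l k := by
    rw [Finset.sum_comm]
    exact Finset.sum_congr rfl fun i _ => Finset.sum_comm
  have h4 : ∑ k, ∑ i, ∑ j ∈ Finset.univ.filter (fun j => j ≠ i), q i k * q j k / ∑ l, q l k ≤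
      ∑ k, 2 * ∑ i ∈ Finset.univ.filter (fun i => i ≠ k), q i k :=
    Finset.sum_le_sum fun k _ => sum_offDiag_mul_div_le (fun i => hq i k) k
  have h5 : ∑ k, 2 * ∑ i ∈ Finset.univ.filter (fun i => i ≠ k), q i k =
      2 * ∑ i, ∑ k ∈ Finset.univ.filter (fun k => k ≠ i), q i k := by
    rw [← Finset.mul_sum]
    congr 1
    simp only [Finset.sum_filter]
    rw [Finset.sum_comm]
    simp only [ne_comm]
  linarith

theorem tr_mul_sum_effect [Fintype I] (P : POVM I X) {ρ : Op X} (hρ : IsDensity ρ) :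
    ∑ k, (tr (P.effect k * ρ)).re = 1 := by
  have hd : ∀ k, DiagSummable (P.effect k * ρ) := fun k => by
    have := diagSummable_comp (hρ.hilbertSchmidt.comp_left (P.effect k)) hρ.hilbertSchmidt
    rwa [ContinuousLinearMap.comp_assoc, opSqrt_comp_self hρ.nonneg] at this
  rw [← Complex.re_sum, ← tr_sum _ fun k _ => hd k, ← Finset.sum_mul, P.sum_eq_one, one_mul,
    hρ.tr_eq_one, Complex.one_re]

theorem half_sum_fidelity_sq_le_errorProb [Fintype I] [DecidableEq I] {ρ : I → Op X}
    (hρ : ∀ i, IsDensity (ρ i)) {c : ℝ} (hc : 0 ≤ c) (hcard : Fintype.card I * c = 1)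
    (P : POVM I X) :
    c ^ 2 * (∑ i, ∑ j ∈ Finset.univ.filter (fun j => j ≠ i), fidelity (ρ i) (ρ j) ^ 2) / 2 ≤
      errorProb (fun _ => c) ρ P := by
  have hq : ∀ i k, 0 ≤ c * (tr (P.effect k * ρ i)).re := fun i k =>
    mul_nonneg hc (tr_mul_re_nonneg (P.nonneg k) (hρ i))
  refine le_trans ?_ (half_sum_sq_bhattacharyya_le hq ?_)
  · rw [Finset.mul_sum]
    gcongr with i _
    rw [Finset.mul_sum]
    gcongr with j _
    rw [← mul_pow]
    have h : c * fidelity (ρ i) (ρ j) ≤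
        ∑ k, √(c * (tr (P.effect k * ρ i)).re) * √(c * (tr (P.effect k * ρ j)).re) := by
      refine (mul_le_mul_of_nonneg_left (fidelity_le_sum_measurement P (hρ i) (hρ j)) hc).trans ?_
      rw [Finset.mul_sum]
      refine Finset.sum_le_sum fun k _ => le_of_eq ?_
      rw [Real.sqrt_mul hc, Real.sqrt_mul hc]
      calc _ = (√c * √c) * _ := by rw [Real.mul_self_sqrt hc]
        _ = _ := by ring
    exact pow_le_pow_left₀ (mul_nonneg hc (fidelity_nonneg _ _)) h 2
  · simp only [← Finset.mul_sum, tr_mul_sum_effect P (hρ _)]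
    simpa [mul_comm] using hcard

end LowerBound

/-! ### An upper bound on the error probability -/

section TraceProduct

variable {X : Type}

theorem inner_ket_comp {A : Op X} (hA : 0 ≤ A) (x y : X) :
    A (ket y) x = inner ℂ (opSqrt A (ket x)) (opSqrt A (ket y)) := by
  rw [← inner_ket_left, ← ContinuousLinearMap.adjoint_inner_right, adjoint_opSqrt,
    ← ContinuousLinearMap.comp_apply, opSqrt_comp_self hA]

/-- Writing both matrices as Gram matrices of the columns `a`, `b` of the square roots turns the
double sum into `∑_z ‖∑_x conj (a_x(z)) b_x‖²`. Truncation to a finite set keeps all interchanges of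
sums trivial. -/
theorem re_sum_entry_mul_nonneg {A B : Op X} (hA : 0 ≤ A) (hB : 0 ≤ B) (F : Finset X) :
    0 ≤ (∑ x ∈ F, ∑ y ∈ F, A (ket y) x * B (ket x) y).re := by
  set a := fun x => opSqrt A (ket x)
  set b := fun x => opSqrt B (ket x)
  have h1 : HasSum (fun z => ∑ x ∈ F, ∑ y ∈ F, star (a x z) * a y z * inner ℂ (b y) (b x))
      (∑ x ∈ F, ∑ y ∈ F, A (ket y) x * B (ket x) y) := by
    refine hasSum_sum fun x _ => hasSum_sum fun y _ => ?_
    rw [inner_ket_comp hA x y, inner_ket_comp hB y x]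
    exact (hasSum_inner (a x) (a y)).mul_right _
  have h2 : ∀ z, ∑ x ∈ F, ∑ y ∈ F, star (a x z) * a y z * inner ℂ (b y) (b x) =
      inner ℂ (∑ y ∈ F, star (a y z) • b y) (∑ x ∈ F, star (a x z) • b x) := fun z => by
    rw [inner_sum]
    refine Finset.sum_congr rfl fun x _ => ?_
    rw [sum_inner]
    refine Finset.sum_congr rfl fun y _ => ?_
    rw [inner_smul_left, inner_smul_right]
    simp only [RCLike.star_def, RCLike.conj_conj]
    ring
  have h3 := Complex.hasSum_re h1
  refine h3.nonneg fun z => ?_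
  rw [h2]
  exact inner_self_nonneg (𝕜 := ℂ)

theorem tr_comp_re_nonneg {A B : Op X} (hA : 0 ≤ A) (hB : 0 ≤ B) (hA' : HilbertSchmidt A)
    (hB' : HilbertSchmidt B) : 0 ≤ (tr (A ∘L B)).re := by
  have hs : Summable fun p : X × X => A (ket p.2) p.1 * B (ket p.1) p.2 := by
    refine Summable.of_norm_bounded
      (((Equiv.prodComm X X).summable_iff.2 hA'.summable_entries).add hB'.summable_entries)
      fun p => ?_
    rw [norm_mul]
    simp only [Function.comp, Equiv.prodComm_apply, Prod.fst_swap, Prod.snd_swap]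
    nlinarith [sq_nonneg (‖A (ket p.2) p.1‖ - ‖B (ket p.1) p.2‖), sq_nonneg (‖A (ket p.2) p.1‖),
      sq_nonneg (‖B (ket p.1) p.2‖)]
  have ht : tr (A ∘L B) = ∑' p : X × X, A (ket p.2) p.1 * B (ket p.1) p.2 := by
    rw [tr_eq, hs.tsum_prod]
    exact tsum_congr fun x => (entry_comp A B x x).tsum_eq.symm
  -- Finite squares `F × F` are cofinal among the finite sets of index pairs, so the trace is a
  -- limit of the truncated sums.
  have h := (Complex.hasSum_re hs.hasSum).comp
    (Filter.tendsto_finsetProd_atTop.comp Filter.tendsto_atTop_diagonal)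
  rw [ht]
  refine ge_of_tendsto h (Filter.Eventually.of_forall fun F => ?_)
  have := re_sum_entry_mul_nonneg hA hB F
  simpa [Finset.sum_product] using this

end TraceProduct

/-! ### Direct sums of copies of one Hilbert space. -/

section Pullback

variable {X Y : Type}

/-- Restriction of the labels along an injective map. -/
def pullback (f : Y → X) (hf : Function.Injective f) : H X →L[ℂ] H Y :=
  LinearMap.mkContinuous
    { toFun := fun ψ => ⟨fun y => ψ (f y), memℓp_two ((summable_sq ψ).comp_injective hf)⟩
      map_add' := fun ψ φ => by ext; rfl
      map_smul' := fun c ψ => by ext; rfl }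
    1 fun ψ => by
      refine lp.norm_le_of_tsum_le (by norm_num) (by positivity) ?_
      have := tsum_comp_le_tsum_of_inj (summable_sq ψ) (fun _ => by positivity) hf
      rw [(hasSum_norm_sq ψ).tsum_eq] at this
      simpa using! this

theorem norm_pullback_le (f : Y → X) (hf : Function.Injective f) : ‖pullback f hf‖ ≤ 1 :=
  LinearMap.mkContinuous_norm_le _ zero_le_one _

variable {I : Type}

/-- The component `i` of a vector of `H (I × X)`. -/
def blockProj (X : Type) (i : I) : H (I × X) →L[ℂ] H X :=
  pullback (fun x => (i, x)) (Prod.mk_right_injective i)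

theorem blockProj_apply (i : I) (ψ : H (I × X)) (x : X) : blockProj X i ψ x = ψ (i, x) := rfl

theorem norm_blockProj_le (i : I) : ‖blockProj X i‖ ≤ 1 := norm_pullback_le _ _

theorem blockProj_adjoint_apply [DecidableEq I] (i j : I) (φ : H X) (x : X) :
    ((blockProj X i)†) φ (j, x) = if j = i then φ x else 0 := by
  classical
  have h : blockProj X i (ket (j, x)) = if j = i then ket x else 0 := by
    ext y
    rw [blockProj_apply, ket_apply]
    split_ifs with h1 h2 h2
    · rw [ket_apply, if_pos (Prod.ext_iff.1 h1).2]
    · exact (h2 (Prod.ext_iff.1 h1).1.symm).elim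
    · rw [ket_apply, if_neg fun h3 => h1 (by rw [h2, h3])]
    · rfl
  rw [← inner_ket_left, ContinuousLinearMap.adjoint_inner_right, h]
  split_ifs
  · rw [inner_ket_left]
  · rw [inner_zero_left]

theorem blockProj_comp_adjoint (i : I) :
    blockProj X i ∘L (blockProj X i)† = ContinuousLinearMap.id ℂ (H X) := by
  classical
  ext φ x
  simp [blockProj_apply, blockProj_adjoint_apply]

theorem blockProj_comp_adjoint_of_ne {i j : I} (h : i ≠ j) :
    blockProj X i ∘L (blockProj X j)† = 0 := by
  classical
  ext φ x
  simp [blockProj_apply, blockProj_adjoint_apply, h]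

theorem sum_blockProj [Fintype I] :
    ∑ i, (blockProj X i)† ∘L blockProj X i = ContinuousLinearMap.id ℂ (H (I × X)) := by
  classical
  ext ψ ⟨j, x⟩
  rw [sum_entry]
  simp [blockProj_apply, blockProj_adjoint_apply]

end Pullback

/-! ### The square-root measurement and the Barnum–Knill estimate. -/

section UpperBound

variable {X I : Type}

theorem one_sub_adjoint_comp_nonneg {Y : Type} {V : H X →L[ℂ] H Y} (hV : ‖V‖ ≤ 1) :
    0 ≤ ContinuousLinearMap.id ℂ (H X) - V† ∘L V := by
  rw [ContinuousLinearMap.nonneg_iff_isPositive, ContinuousLinearMap.isPositive_iff_complex]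
  intro x
  have h : inner ℂ ((ContinuousLinearMap.id ℂ (H X) - V† ∘L V) x) x =
      ((‖x‖ ^ 2 - ‖V x‖ ^ 2 : ℝ) : ℂ) := by
    rw [Complex.ofReal_sub, Complex.ofReal_pow, Complex.ofReal_pow, sub_apply,
      inner_sub_left, ContinuousLinearMap.comp_apply,
      ContinuousLinearMap.adjoint_inner_left, ContinuousLinearMap.id_apply,
      inner_self_eq_norm_sq_to_K, inner_self_eq_norm_sq_to_K]
    rfl
  rw [h]
  have h1 : ‖V x‖ ≤ ‖x‖ := by simpa using V.le_of_opNorm_le hV x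
  refine ⟨rfl, ?_⟩
  rw [RCLike.re_to_complex, Complex.ofReal_re, sub_nonneg]
  exact pow_le_pow_left₀ (norm_nonneg _) h1 2

theorem hsNormSq_opAbs {Y : Type} (T : H X →L[ℂ] H Y) : hsNormSq (opAbs T) = hsNormSq T := by
  simp only [hsNormSq, norm_opAbs_apply]

/-- The estimate behind the Barnum–Knill bound: if `K† K + L† L` acts as the identity on the range
of `R ≥ 0`, the trace norm of `K R R L†` is at least twice the squared Hilbert–Schmidt norm of
`K R L†`. -/
theorem exists_contraction_two_mul_hsNormSq_le {Y Z : Type} {R : Op X} (hR : 0 ≤ R)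
    (hR' : HilbertSchmidt R) (K : H X →L[ℂ] H Y) (L : H X →L[ℂ] H Z)
    (hKL : (K† ∘L K + L† ∘L L) ∘L R = R) :
    ∃ U : H Z →L[ℂ] H Y, ‖U‖ ≤ 1 ∧
      2 * hsNormSq (K ∘L R ∘L L†) ≤ (tr (U† ∘L K ∘L R ∘L R ∘L L†)).re := by
  obtain ⟨Q, hQ⟩ : ∃ Q, Q = K ∘L R ∘L L† := ⟨_, rfl⟩
  have hQ' : HilbertSchmidt Q := hQ ▸ (hR'.comp_right (L†)).comp_left K
  obtain ⟨U, hU, hUQ, hUQ'⟩ := exists_polar Q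
  refine ⟨U, hU, ?_⟩
  have hRa : R† = R := adjoint_of_nonneg hR
  obtain ⟨S, hS⟩ : ∃ S, S = opAbs Q := ⟨_, rfl⟩
  rw [← hS] at hUQ hUQ'
  have hS0 : 0 ≤ S := hS ▸ opAbs_nonneg Q
  have hSa : S† = S := adjoint_of_nonneg hS0
  have hS' : HilbertSchmidt S := hUQ' ▸ hQ'.comp_left _
  have hQU : Q† ∘L U = S := by
    have := congrArg ContinuousLinearMap.adjoint hUQ'
    rwa [hSa, ContinuousLinearMap.adjoint_comp, ContinuousLinearMap.adjoint_adjoint] at this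
  -- The heart of the estimate: with `D = U† K - L`, the operator `D R D†` is positive and equals `A
  -- + B - 2 S`. Its trace against `S ≥ 0` is nonnegative, so `Tr A S + Tr B S ≥ 2 Tr S²`.
  have hpos : 0 ≤ (U† ∘L K - L) ∘L R ∘L (K† ∘L U - L†) := by
    rw [ContinuousLinearMap.nonneg_iff_isPositive] at hR ⊢
    have := hR.adjoint_conj (K† ∘L U - L†)
    rwa [map_sub, ContinuousLinearMap.adjoint_comp, ContinuousLinearMap.adjoint_adjoint,
      ContinuousLinearMap.adjoint_adjoint] at this
  have hDRD' : HilbertSchmidt ((U† ∘L K - L) ∘L R ∘L (K† ∘L U - L†)) :=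
    (hR'.comp_right _).comp_left _
  obtain ⟨A, hA⟩ : ∃ A, A = U† ∘L K ∘L R ∘L K† ∘L U := ⟨_, rfl⟩
  obtain ⟨B, hB⟩ : ∃ B, B = L ∘L R ∘L L† := ⟨_, rfl⟩
  have hA' : HilbertSchmidt A :=
    hA ▸ ((hR'.comp_right (K† ∘L U)).comp_left K).comp_left (U†)
  have hB' : HilbertSchmidt B := hB ▸ (hR'.comp_right (L†)).comp_left L
  have hDRD : (U† ∘L K - L) ∘L R ∘L (K† ∘L U - L†) = A + B + -(S + S) := by
    have h1 : U† ∘L K ∘L R ∘L L† = S := by rw [← hUQ', hQ]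
    have h2 : L ∘L R ∘L K† ∘L U = S := by
      rw [← hQU, hQ]
      simp only [ContinuousLinearMap.adjoint_comp, ContinuousLinearMap.adjoint_adjoint, hRa,
        ContinuousLinearMap.comp_assoc]
    simp only [ContinuousLinearMap.sub_comp, ContinuousLinearMap.comp_sub,
      ContinuousLinearMap.comp_assoc]
    rw [h1, h2, hA, hB]
    abel
  have key := tr_comp_re_nonneg hpos hS0 hDRD' hS'
  have dA : DiagSummable (A ∘L S) := diagSummable_comp hA' hS'
  have dB : DiagSummable (B ∘L S) := diagSummable_comp hB' hS'
  have dS : DiagSummable (S ∘L S) := diagSummable_comp hS' hS'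
  have trS : tr (S ∘L S) = (hsNormSq Q : ℂ) := by
    have := tr_adjoint_comp_self S
    rwa [hSa, hS, hsNormSq_opAbs, ← hS] at this
  have htr : tr ((A + B + -(S + S)) ∘L S) =
      tr (A ∘L S) + tr (B ∘L S) + -(hsNormSq Q + hsNormSq Q : ℂ) := by
    have e : (A + B + -(S + S)) ∘L S = A ∘L S + B ∘L S + -(S ∘L S + S ∘L S) := by
      simp only [ContinuousLinearMap.add_comp, ContinuousLinearMap.neg_comp]
    have dS' : DiagSummable (-(S ∘L S + S ∘L S)) := by
      simpa [DiagSummable] using (dS.add dS).neg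
    rw [e, tr_add (dA.add dB) dS', tr_add dA dB, tr_neg, tr_add dS dS, trS]
  -- The hypothesis `hKL` resolves the inner `R L†` into `K† Q + L† B`. The operator whose trace is
  -- to be bounded is thereby `A S + S B`, with exactly the two traces controlled by `key`.
  have hG : U† ∘L K ∘L R ∘L R ∘L L† = A ∘L S + S ∘L B := by
    have h0 : R ∘L L† = K† ∘L Q + L† ∘L B := by
      conv_lhs => rw [← hKL]
      rw [hB, hQ]
      simp only [ContinuousLinearMap.add_comp, ContinuousLinearMap.comp_assoc]
    have h1 : A ∘L S = U† ∘L K ∘L R ∘L K† ∘L Q := by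
      rw [hA, ← hUQ]; simp only [ContinuousLinearMap.comp_assoc]
    have h2 : S ∘L B = U† ∘L K ∘L R ∘L L† ∘L B := by
      rw [← hUQ', hQ]; simp only [ContinuousLinearMap.comp_assoc]
    rw [h1, h2, h0]
    simp only [ContinuousLinearMap.comp_add]
  rw [hDRD, htr] at key
  rw [← hQ]
  rw [hG, tr_add dA (diagSummable_comp hS' hB'), tr_comp_comm hS' hB']
  simp only [Complex.add_re, Complex.neg_re, Complex.ofReal_re] at key ⊢
  linarith

/-- The square-root measurement, as the polar part `V` of the column of the operators `√ρᵢ`. -/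
theorem exists_polar_family [Fintype I] {ρ : I → Op X} (hρ : ∀ i, IsDensity (ρ i)) :
    ∃ (R : Op X) (V : H X →L[ℂ] H (I × X)), 0 ≤ R ∧ HilbertSchmidt R ∧ ‖V‖ ≤ 1 ∧
      V† ∘L V ∘L R = R ∧ ∀ i, blockProj X i ∘L V ∘L R = opSqrt (ρ i) := by
  classical
  -- The column of the `√ρᵢ` satisfies `T† T = ∑ᵢ ρᵢ`, so its absolute value is the square root of
  -- the sum of the states, and the polar part plays the role of `T (∑ᵢ ρᵢ)^{-1/2}` without
  -- inverting anything.
  obtain ⟨T, hT⟩ : ∃ T, T = ∑ i, (blockProj X i)† ∘L opSqrt (ρ i) := ⟨_, rfl⟩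
  have hT' : HilbertSchmidt T :=
    hT ▸ HilbertSchmidt.sum _ fun i _ => (hρ i).hilbertSchmidt.comp_left _
  obtain ⟨V, hV, h1, h2⟩ := exists_polar T
  refine ⟨opAbs T, V, opAbs_nonneg T, h2 ▸ hT'.comp_left _, hV, by rw [h1, h2], fun i => ?_⟩
  rw [h1, hT, ContinuousLinearMap.comp_finsetSum, Finset.sum_eq_single i]
  · rw [← ContinuousLinearMap.comp_assoc, blockProj_comp_adjoint, ContinuousLinearMap.id_comp]
  · intro j _ hj
    rw [← ContinuousLinearMap.comp_assoc, blockProj_comp_adjoint_of_ne hj.symm,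
      ContinuousLinearMap.zero_comp]
  · simp

theorem adjoint_comp_sum_blockProj (s : Finset I) {Y : Type} (A : I → H Y →L[ℂ] H X) :
    (∑ i ∈ s, (blockProj X i)† ∘L A i)† ∘L (∑ i ∈ s, (blockProj X i)† ∘L A i) =
      ∑ i ∈ s, (A i)† ∘L A i := by
  classical
  rw [map_sum, ContinuousLinearMap.finsetSum_comp]
  refine Finset.sum_congr rfl fun i hi => ?_
  rw [ContinuousLinearMap.adjoint_comp, ContinuousLinearMap.adjoint_adjoint,
    ContinuousLinearMap.comp_finsetSum, Finset.sum_eq_single i]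
  · rw [ContinuousLinearMap.comp_assoc, ← ContinuousLinearMap.comp_assoc (blockProj X i),
      blockProj_comp_adjoint, ContinuousLinearMap.id_comp]
  · intro j _ hj
    rw [ContinuousLinearMap.comp_assoc, ← ContinuousLinearMap.comp_assoc (blockProj X i),
      blockProj_comp_adjoint_of_ne hj.symm, ContinuousLinearMap.zero_comp,
      ContinuousLinearMap.comp_zero]
  · exact fun h => (h hi).elim

theorem hsNormSq_sum_blockProj_adjoint_comp (s : Finset I) {Y : Type} {A : I → H Y →L[ℂ] H X}
    (hA : ∀ i, HilbertSchmidt (A i)) :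
    hsNormSq (∑ i ∈ s, (blockProj X i)† ∘L A i) = ∑ i ∈ s, hsNormSq (A i) := by
  have h1 := tr_adjoint_comp_self (∑ i ∈ s, (blockProj X i)† ∘L A i)
  rw [adjoint_comp_sum_blockProj,
    tr_sum _ fun i _ => diagSummable_adjoint_comp (hA i) (hA i)] at h1
  simp only [tr_adjoint_comp_self] at h1
  exact_mod_cast h1.symm

/-- Collect the measurement operators `L j` of the wrong outcomes `j ≠ i` into one column `K`. As `R
(L i)† = √ρᵢ`, the squared norm of `K R (L i)†` is the error given `ρᵢ`. The blocks of `K R R (L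
i)†` are `√ρⱼ √ρᵢ`, whose trace norms are the fidelities. -/
theorem sum_hsNormSq_offDiag_le [Fintype I] [DecidableEq I] {ρ : I → Op X}
    (hρ : ∀ i, IsDensity (ρ i))
    {R : Op X} {V : H X →L[ℂ] H (I × X)} (hR : 0 ≤ R) (hR' : HilbertSchmidt R)
    (hVR : V† ∘L V ∘L R = R) (hV : ∀ i, blockProj X i ∘L V ∘L R = opSqrt (ρ i)) (i : I) :
    2 * ∑ j ∈ Finset.univ.filter (fun j => j ≠ i), hsNormSq (blockProj X j ∘L V ∘L opSqrt (ρ i)) ≤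
      ∑ j ∈ Finset.univ.filter (fun j => j ≠ i), fidelity (ρ i) (ρ j) := by
  obtain ⟨s, hs⟩ : ∃ s, s = Finset.univ.filter (fun j => j ≠ i) := ⟨_, rfl⟩
  have hRa : R† = R := adjoint_of_nonneg hR
  obtain ⟨L, hL⟩ : ∃ L, L = fun j => blockProj X j ∘L V := ⟨_, rfl⟩
  have hLR : ∀ j, L j ∘L R = opSqrt (ρ j) := fun j => by
    rw [hL, ← hV j, ContinuousLinearMap.comp_assoc]
  have hRL : ∀ j, R ∘L (L j)† = opSqrt (ρ j) := fun j => by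
    have := congrArg ContinuousLinearMap.adjoint (hLR j)
    rwa [ContinuousLinearMap.adjoint_comp, hRa, adjoint_opSqrt] at this
  obtain ⟨K, hK⟩ : ∃ K, K = ∑ j ∈ s, (blockProj X j)† ∘L L j := ⟨_, rfl⟩
  have hLL : ∀ j, (L j)† ∘L L j = V† ∘L ((blockProj X j)† ∘L blockProj X j) ∘L V := fun j => by
    rw [hL]
    simp only [ContinuousLinearMap.adjoint_comp, ContinuousLinearMap.comp_assoc]
  have hKK : K† ∘L K = ∑ j ∈ s, (L j)† ∘L L j := hK ▸ adjoint_comp_sum_blockProj s L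
  have hKL : (K† ∘L K + (L i)† ∘L L i) ∘L R = R := by
    have h1 : K† ∘L K + (L i)† ∘L L i = V† ∘L V := by
      rw [hKK, hs, Finset.filter_ne', add_comm,
        Finset.add_sum_erase _ (fun j => (L j)† ∘L L j) (Finset.mem_univ i)]
      simp only [hLL, ← ContinuousLinearMap.comp_finsetSum, ← ContinuousLinearMap.finsetSum_comp]
      rw [sum_blockProj, ContinuousLinearMap.id_comp]
    rw [h1, ContinuousLinearMap.comp_assoc, hVR]
  obtain ⟨U, hU, h⟩ := exists_contraction_two_mul_hsNormSq_le hR hR' K (L i) hKL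
  have h1 : hsNormSq (K ∘L R ∘L (L i)†) = ∑ j ∈ s, hsNormSq (L j ∘L opSqrt (ρ i)) := by
    rw [hRL, hK, ContinuousLinearMap.finsetSum_comp]
    simp only [ContinuousLinearMap.comp_assoc]
    exact hsNormSq_sum_blockProj_adjoint_comp s fun j => (hρ i).hilbertSchmidt.comp_left (L j)
  have h2 : U† ∘L K ∘L R ∘L R ∘L (L i)† =
      ∑ j ∈ s, (U† ∘L (blockProj X j)†) ∘L opSqrt (ρ j) ∘L opSqrt (ρ i) := by
    rw [hRL, hK, ContinuousLinearMap.finsetSum_comp, ContinuousLinearMap.comp_finsetSum]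
    refine Finset.sum_congr rfl fun j _ => ?_
    rw [← hLR j]
    simp only [ContinuousLinearMap.comp_assoc]
  have h3 : ∀ j, (tr ((U† ∘L (blockProj X j)†) ∘L opSqrt (ρ j) ∘L opSqrt (ρ i))).re ≤
      fidelity (ρ i) (ρ j) := fun j => by
    rw [fidelity_eq_traceNorm _ (hρ j).nonneg]
    refine (Complex.re_le_norm _).trans
      (norm_tr_comp_le_traceNorm (hρ j).hilbertSchmidt (hρ i).hilbertSchmidt ?_)
    exact (ContinuousLinearMap.opNorm_comp_le _ _).trans (mul_le_one₀ (norm_adjoint_le hU)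
      (norm_nonneg _) (norm_adjoint_le (norm_blockProj_le j)))
  rw [h1, h2, tr_sum, Complex.re_sum] at h
  · have h4 := h.trans (Finset.sum_le_sum fun j _ => h3 j)
    rw [hL] at h4
    rw [← hs]
    simpa only [ContinuousLinearMap.comp_assoc] using h4
  · intro j _
    rw [← ContinuousLinearMap.comp_assoc]
    exact diagSummable_comp ((hρ j).hilbertSchmidt.comp_left _) (hρ i).hilbertSchmidt

theorem minErrorProb_le_sum_fidelity [Fintype I] [DecidableEq I] [Nonempty I] {ρ : I → Op X}
    (hρ : ∀ i, IsDensity (ρ i)) {c : ℝ} (hc : 0 ≤ c) :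
    minErrorProb (fun _ => c) ρ ≤
      c * ∑ i, ∑ j ∈ Finset.univ.filter (fun j => j ≠ i), fidelity (ρ i) (ρ j) := by
  obtain ⟨R, V, hR, hR', hV1, hVR, hV⟩ := exists_polar_family hρ
  have hRa : R† = R := adjoint_of_nonneg hR
  obtain ⟨i₀⟩ := ‹Nonempty I›
  -- The operators built from `V` sum to `V† V`, which may be smaller than one. The defect is
  -- assigned to an arbitrary outcome `i₀`; it annihilates every `ρᵢ` and so changes no probability.
  obtain ⟨C, hC⟩ : ∃ C, C = ContinuousLinearMap.id ℂ (H X) - V† ∘L V := ⟨_, rfl⟩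
  have hC0 : 0 ≤ C := hC ▸ one_sub_adjoint_comp_nonneg hV1
  let P : POVM I X :=
    { effect := fun i => (blockProj X i ∘L V)† ∘L (blockProj X i ∘L V) + if i = i₀ then C else 0
      nonneg := fun i => by
        refine add_nonneg (adjoint_comp_self_nonneg _) ?_
        split_ifs
        exacts [hC0, le_rfl]
      sum_eq_one := by
        have : ∀ i, (blockProj X i ∘L V)† ∘L (blockProj X i ∘L V) =
            V† ∘L ((blockProj X i)† ∘L blockProj X i) ∘L V := fun i => by
          simp only [ContinuousLinearMap.adjoint_comp, ContinuousLinearMap.comp_assoc]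
        rw [Finset.sum_add_distrib, Finset.sum_ite_eq' Finset.univ i₀, if_pos (Finset.mem_univ _)]
        simp only [this, ← ContinuousLinearMap.comp_finsetSum,
          ← ContinuousLinearMap.finsetSum_comp]
        rw [sum_blockProj, ContinuousLinearMap.id_comp, hC, add_sub_cancel]
        rfl }
  have hCR : C ∘L R = 0 := by
    rw [hC, ContinuousLinearMap.sub_comp, ContinuousLinearMap.id_comp,
      ContinuousLinearMap.comp_assoc, hVR, sub_self]
  have hCρ : ∀ i, C ∘L ρ i = 0 := fun i => by
    have h1 : opSqrt (ρ i) = R ∘L (blockProj X i ∘L V)† := by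
      have := congrArg ContinuousLinearMap.adjoint (hV i)
      rw [← ContinuousLinearMap.comp_assoc, ContinuousLinearMap.adjoint_comp, hRa,
        adjoint_opSqrt] at this
      exact this.symm
    rw [← opSqrt_comp_self (hρ i).nonneg, ← ContinuousLinearMap.comp_assoc]
    conv_lhs => rw [h1]
    rw [← ContinuousLinearMap.comp_assoc C, hCR]
    simp only [ContinuousLinearMap.zero_comp]
  have hP : ∀ i j, (tr (P.effect j * ρ i)).re =
      hsNormSq (blockProj X j ∘L V ∘L opSqrt (ρ i)) := fun i j => by
    have h1 : P.effect j * ρ i = ((blockProj X j ∘L V)† ∘L (blockProj X j ∘L V ∘L opSqrt (ρ i))) ∘L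
        opSqrt (ρ i) := by
      change ((blockProj X j ∘L V)† ∘L (blockProj X j ∘L V) + if j = i₀ then C else 0) ∘L ρ i = _
      have h0 : (if j = i₀ then C else 0) ∘L ρ i = 0 := by
        split_ifs
        exacts [hCρ i, ContinuousLinearMap.zero_comp _]
      rw [ContinuousLinearMap.add_comp, h0, add_zero]
      conv_lhs => rw [← opSqrt_comp_self (hρ i).nonneg]
      simp only [ContinuousLinearMap.comp_assoc]
    have h2 : opSqrt (ρ i) ∘L ((blockProj X j ∘L V)† ∘L (blockProj X j ∘L V ∘L opSqrt (ρ i))) =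
        (blockProj X j ∘L V ∘L opSqrt (ρ i))† ∘L (blockProj X j ∘L V ∘L opSqrt (ρ i)) := by
      simp only [ContinuousLinearMap.adjoint_comp, adjoint_opSqrt, ContinuousLinearMap.comp_assoc]
    rw [h1, tr_comp_comm ((((hρ i).hilbertSchmidt.comp_left V).comp_left _).comp_left _)
      (hρ i).hilbertSchmidt, h2, tr_adjoint_comp_self, Complex.ofReal_re]
  have hbdd : BddBelow (Set.range fun P : POVM I X => errorProb (fun _ => c) ρ P) := by
    refine ⟨0, ?_⟩
    rintro _ ⟨P, rfl⟩
    exact Finset.sum_nonneg fun i _ => Finset.sum_nonneg fun j _ =>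
      mul_nonneg hc (tr_mul_re_nonneg (P.nonneg j) (hρ i))
  refine (ciInf_le hbdd P).trans ?_
  rw [errorProb, Finset.mul_sum]
  refine Finset.sum_le_sum fun i _ => ?_
  rw [← Finset.mul_sum]
  refine mul_le_mul_of_nonneg_left ?_ hc
  simp only [hP]
  have h := sum_hsNormSq_offDiag_le hρ hR hR' hVR hV i
  have h0 : 0 ≤ ∑ j ∈ Finset.univ.filter (fun j => j ≠ i),
      hsNormSq (blockProj X j ∘L V ∘L opSqrt (ρ i)) :=
    Finset.sum_nonneg fun j _ => hsNormSq_nonneg _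
  -- The estimate `h` is stronger by a factor of two, which is discarded here.
  linarith

end UpperBound

/-! ### Tensor products through matrix elements -/

section Tensor

variable {X Y Z : Type}

/-- `C` is the tensor product `A ⊗ B`, the labels of the product being split by `e`. -/
def IsTensor (e : Z ≃ X × Y) (A : Op X) (B : Op Y) (C : Op Z) : Prop :=
  ∀ z z', C (ket z') z = A (ket (e z').1) (e z).1 * B (ket (e z').2) (e z).2

variable {e : Z ≃ X × Y}

theorem IsTensor.unique {A : Op X} {B : Op Y} {C C' : Op Z} (h : IsTensor e A B C)
    (h' : IsTensor e A B C') : C = C' :=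
  op_ext fun z' z => by rw [h z z', h' z z']

theorem IsTensor.adjoint {A : Op X} {B : Op Y} {C : Op Z} (h : IsTensor e A B C) :
    IsTensor e (A†) (B†) (C†) := fun z z' => by
  rw [adjoint_entry, adjoint_entry, adjoint_entry, h, star_mul']

/-- Expanding both factors in the basis gives two absolutely convergent series, whose product is the
expansion of the left side. -/
theorem IsTensor.apply_prod {A : Op X} {B : Op Y} {C : Op Z} (h : IsTensor e A B C)
    {ψ : H Z} {φ : H X} {χ : H Y} (hψ : ∀ z, ψ z = φ (e z).1 * χ (e z).2) (z : Z) :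
    C ψ z = A φ (e z).1 * B χ (e z).2 := by
  have h1 := hasSum_apply A φ (e z).1
  have h2 := hasSum_apply B χ (e z).2
  have hs := summable_mul_of_summable_norm (f := fun x => φ x * A (ket x) (e z).1)
    (g := fun y => χ y * B (ket y) (e z).2) (summable_norm_entry_mul A φ (e z).1)
    (summable_norm_entry_mul B χ (e z).2)
  have h3 := HasSum.mul (f := fun x => φ x * A (ket x) (e z).1)
    (g := fun y => χ y * B (ket y) (e z).2) h1 h2 hs
  refine (hasSum_apply C ψ z).unique ?_
  rw [← e.symm.hasSum_iff]
  refine (congrArg (HasSum · _) (funext fun p => ?_)).mpr h3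
  simp only [Function.comp, hψ, h z, Equiv.apply_symm_apply]
  ring

theorem ket_prod (z z' : Z) : ket z' z = ket (e z').1 (e z).1 * ket (e z').2 (e z).2 := by
  classical
  rw [ket_apply, ket_apply, ket_apply]
  by_cases h : z = z'
  · simp [h]
  · have : ¬((e z).1 = (e z').1 ∧ (e z).2 = (e z').2) := fun h' =>
      h (e.injective (Prod.ext h'.1 h'.2))
    rw [if_neg h]
    split_ifs with h1 h2
    · exact (this ⟨h1, h2⟩).elim
    all_goals simp

/-- Each column of `C'` is a product vector, so `apply_prod` computes its image under `C`. -/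
theorem IsTensor.comp {A A' : Op X} {B B' : Op Y} {C C' : Op Z} (h : IsTensor e A B C)
    (h' : IsTensor e A' B' C') : IsTensor e (A ∘L A') (B ∘L B') (C ∘L C') := fun z z' =>
  h.apply_prod (ψ := C' (ket z')) (φ := A' (ket (e z').1)) (χ := B' (ket (e z').2))
    (fun w => h' w z') z

/-- The slice of a vector at a fixed second label. -/
def sliceAt (e : Z ≃ X × Y) (y : Y) : H Z →L[ℂ] H X :=
  pullback (fun x => e.symm (x, y)) fun x x' h => by simpa using h

theorem hasSum_norm_sq_of_slices (e : Z ≃ X × Y) {f : Z → ℂ} {g : Y → H X}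
    (hg : ∀ z, f z = g (e z).2 (e z).1) {c : ℝ} (h : HasSum (fun y => ‖g y‖ ^ 2) c) :
    HasSum (fun z => ‖f z‖ ^ 2) c := by
  rw [← (e.trans (Equiv.prodComm X Y)).symm.hasSum_iff]
  have e1 : ((fun z => ‖f z‖ ^ 2) ∘ (e.trans (Equiv.prodComm X Y)).symm) =
      fun p : Y × X => ‖g p.1 p.2‖ ^ 2 := by
    funext p
    simp [hg]
  rw [e1]
  have hs : Summable fun p : Y × X => ‖g p.1 p.2‖ ^ 2 := by
    refine (summable_prod_of_nonneg fun p => by positivity).2 ⟨fun y => summable_sq (g y), ?_⟩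
    exact h.summable.congr fun y => (hasSum_norm_sq (g y)).tsum_eq.symm
  rw [hs.hasSum_iff, hs.tsum_prod, tsum_congr fun y => (hasSum_norm_sq (g y)).tsum_eq, h.tsum_eq]

theorem hasSum_norm_sq_sliceAt (e : Z ≃ X × Y) (ψ : H Z) :
    HasSum (fun y => ‖sliceAt e y ψ‖ ^ 2) (‖ψ‖ ^ 2) := by
  have h := ((e.trans (Equiv.prodComm X Y)).symm.hasSum_iff).2 (hasSum_norm_sq ψ)
  refine h.prod_fiberwise fun y => ?_
  exact hasSum_norm_sq (sliceAt e y ψ)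

theorem summable_norm_sq_apply_sliceAt (e : Z ≃ X × Y) (A : Op X) (ψ : H Z) :
    Summable (fun y => ‖A (sliceAt e y ψ)‖ ^ 2) ∧
      ∑' y, ‖A (sliceAt e y ψ)‖ ^ 2 ≤ ‖A‖ ^ 2 * ‖ψ‖ ^ 2 := by
  have hle : ∀ y, ‖A (sliceAt e y ψ)‖ ^ 2 ≤ ‖A‖ ^ 2 * ‖sliceAt e y ψ‖ ^ 2 := fun y => by
    rw [← mul_pow]
    exact pow_le_pow_left₀ (norm_nonneg _) (A.le_opNorm _) 2
  have h := (hasSum_norm_sq_sliceAt e ψ).mul_left (‖A‖ ^ 2)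
  have hs := Summable.of_nonneg_of_le (fun _ => sq_nonneg _) hle h.summable
  exact ⟨hs, hasSum_le hle hs.hasSum h⟩

/-- The operator `A ⊗ 1`. -/
def amplify (e : Z ≃ X × Y) (A : Op X) : Op Z :=
  LinearMap.mkContinuous
    { toFun := fun ψ => ⟨fun z => A (sliceAt e (e z).2 ψ) (e z).1,
        memℓp_two (hasSum_norm_sq_of_slices e (g := fun y => A (sliceAt e y ψ)) (fun _ => rfl)
          (summable_norm_sq_apply_sliceAt e A ψ).1.hasSum).summable⟩
      map_add' := fun ψ φ => by
        ext z
        simp only [map_add]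
        rfl
      map_smul' := fun c ψ => by
        ext z
        simp }
    ‖A‖ fun ψ => by
      refine lp.norm_le_of_tsum_le (by norm_num) (by positivity) ?_
      have h := hasSum_norm_sq_of_slices e (f := fun z => A (sliceAt e (e z).2 ψ) (e z).1)
        (g := fun y => A (sliceAt e y ψ)) (fun _ => rfl)
        (summable_norm_sq_apply_sliceAt e A ψ).1.hasSum
      have h' := (summable_norm_sq_apply_sliceAt e A ψ).2
      rw [← h.tsum_eq] at h'
      simpa [mul_pow] using! h'

theorem amplify_apply (e : Z ≃ X × Y) (A : Op X) (ψ : H Z) (z : Z) :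
    amplify e A ψ z = A (sliceAt e (e z).2 ψ) (e z).1 := rfl

theorem hasSum_norm_sq_amplify (e : Z ≃ X × Y) (A : Op X) (ψ : H Z) :
    HasSum (fun y => ‖A (sliceAt e y ψ)‖ ^ 2) (‖amplify e A ψ‖ ^ 2) := by
  have h := (summable_norm_sq_apply_sliceAt e A ψ).1.hasSum
  have h' := hasSum_norm_sq_of_slices e (f := amplify e A ψ)
    (g := fun y => A (sliceAt e y ψ)) (fun _ => rfl) h
  rwa [h'.unique (hasSum_norm_sq (amplify e A ψ))] at h

theorem isTensor_amplify (e : Z ≃ X × Y) (A : Op X) : IsTensor e A 1 (amplify e A) := by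
  classical
  intro z z'
  have h : sliceAt e (e z).2 (ket z') = ket (e z').2 (e z).2 • ket (e z').1 := by
    ext x
    change ket z' (e.symm (x, (e z).2)) = ket (e z').2 (e z).2 * ket (e z').1 x
    rw [ket_prod (e := e), Equiv.apply_symm_apply, mul_comm]
  rw [amplify_apply, h]
  simp [mul_comm]

theorem IsTensor.swap {A : Op X} {B : Op Y} {C : Op Z} (h : IsTensor e A B C) :
    IsTensor (e.trans (Equiv.prodComm X Y)) B A C := fun z z' => by
  rw [h z z', mul_comm]
  rfl

/-- Existence of the tensor product as a bounded operator, in the form `(A ⊗ 1)(1 ⊗ B)`; by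
uniqueness every `IsTensor` operator has this form. -/
theorem isTensor_amplify_comp (e : Z ≃ X × Y) (A : Op X) (B : Op Y) :
    IsTensor e A B (amplify e A ∘L amplify (e.trans (Equiv.prodComm X Y)) B) :=
  (isTensor_amplify e A).comp (A' := 1) (B := 1) (B' := B)
    (isTensor_amplify (e.trans (Equiv.prodComm X Y)) B).swap

theorem IsTensor.eq_amplify_comp {A : Op X} {B : Op Y} {C : Op Z} (h : IsTensor e A B C) :
    C = amplify e A ∘L amplify (e.trans (Equiv.prodComm X Y)) B :=
  h.unique (isTensor_amplify_comp e A B)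

/-- A tensor product of positive operators is `T† T` with `T = √A ⊗ √B`, hence positive. Then `√A ⊗
√B` is itself positive and squares to `A ⊗ B`, so it is the unique positive square root. -/
theorem isTensor_opSqrt {A : Op X} {B : Op Y} {C : Op Z} (h : IsTensor e A B C) (hA : 0 ≤ A)
    (hB : 0 ≤ B) : 0 ≤ C ∧ IsTensor e (opSqrt A) (opSqrt B) (opSqrt C) := by
  have nonneg : ∀ {A : Op X} {B : Op Y} {C : Op Z}, IsTensor e A B C → 0 ≤ A → 0 ≤ B → 0 ≤ C := by
    intro A B C h hA hB
    have h1 := isTensor_amplify_comp e (opSqrt A) (opSqrt B)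
    have h2 := h1.adjoint.comp h1
    rw [adjoint_opSqrt, adjoint_opSqrt, opSqrt_comp_self hA, opSqrt_comp_self hB] at h2
    rw [h.unique h2]
    exact adjoint_comp_self_nonneg _
  refine ⟨nonneg h hA hB, ?_⟩
  have h1 := isTensor_amplify_comp e (opSqrt A) (opSqrt B)
  have h2 := h1.comp h1
  rw [opSqrt_comp_self hA, opSqrt_comp_self hB] at h2
  rw [opSqrt_unique (h2.unique h) (nonneg h1 (opSqrt_nonneg A) (opSqrt_nonneg B))]
  exact h1

theorem IsTensor.hasSum_diag {A : Op X} {B : Op Y} {C : Op Z} (h : IsTensor e A B C) {a b : ℂ}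
    (hA : HasSum (fun x => A (ket x) x) a) (hB : HasSum (fun y => B (ket y) y) b) :
    HasSum (fun z => C (ket z) z) (a * b) := by
  rw [← e.symm.hasSum_iff]
  have hs := summable_mul_of_summable_norm (f := fun x => A (ket x) x) (g := fun y => B (ket y) y)
    hA.summable.norm hB.summable.norm
  refine (congrArg (HasSum · _) (funext fun p => ?_)).mpr
    (HasSum.mul (f := fun x => A (ket x) x) (g := fun y => B (ket y) y) hA hB hs)
  simp only [Function.comp, h (e.symm p), Equiv.apply_symm_apply]

theorem IsTensor.tr_eq {A : Op X} {B : Op Y} {C : Op Z} (h : IsTensor e A B C)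
    (hA : DiagSummable A) (hB : DiagSummable B) : tr C = tr A * tr B := by
  rw [BosonicDiscrimination.tr_eq, (h.hasSum_diag hA.hasSum hB.hasSum).tsum_eq,
    BosonicDiscrimination.tr_eq, BosonicDiscrimination.tr_eq]

theorem IsTensor.isDensity {A : Op X} {B : Op Y} {C : Op Z} (h : IsTensor e A B C)
    (hA : IsDensity A) (hB : IsDensity B) : IsDensity C :=
  ⟨(isTensor_opSqrt h hA.nonneg hB.nonneg).1, by simpa using h.hasSum_diag hA.hasSum hB.hasSum⟩

theorem sandwich_nonneg {ρ σ : Op X} (hσ : 0 ≤ σ) : 0 ≤ opSqrt ρ * σ * opSqrt ρ := by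
  have := (ContinuousLinearMap.nonneg_iff_isPositive _).1 hσ |>.adjoint_conj (opSqrt ρ)
  rw [adjoint_opSqrt] at this
  exact (ContinuousLinearMap.nonneg_iff_isPositive _).2 this

theorem diagSummable_fidelity {ρ σ : Op X} (hρ : IsDensity ρ) (hσ : IsDensity σ) :
    DiagSummable (opSqrt (opSqrt ρ * σ * opSqrt ρ)) := by
  have h := diagSummable_opAbs hσ.hilbertSchmidt hρ.hilbertSchmidt
  have e1 : opSqrt ρ * σ * opSqrt ρ = (opSqrt σ ∘L opSqrt ρ)† ∘L (opSqrt σ ∘L opSqrt ρ) := by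
    conv_lhs => rw [← opSqrt_comp_self hσ.nonneg]
    simp only [ContinuousLinearMap.adjoint_comp, adjoint_opSqrt]
    rfl
  rw [e1]
  exact h

/-- The fidelity is multiplicative under tensor products. -/
theorem IsTensor.fidelity_eq {A A' : Op X} {B B' : Op Y} {C C' : Op Z} (h : IsTensor e A B C)
    (h' : IsTensor e A' B' C') (hA : IsDensity A) (hB : IsDensity B) (hA' : IsDensity A')
    (hB' : IsDensity B') : fidelity C C' = fidelity A A' * fidelity B B' := by
  have h1 := (isTensor_opSqrt h hA.nonneg hB.nonneg).2
  have h2 : IsTensor e (opSqrt A * A' * opSqrt A) (opSqrt B * B' * opSqrt B)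
      (opSqrt C * C' * opSqrt C) := (h1.comp h').comp h1
  have h3 := (isTensor_opSqrt h2 (sandwich_nonneg hA'.nonneg) (sandwich_nonneg hB'.nonneg)).2
  -- Both traces are real, so the real part of their product is the product of the real parts.
  rw [fidelity, h3.tr_eq (diagSummable_fidelity hA hA') (diagSummable_fidelity hB hB'),
    tr_eq_hsNormSq (opSqrt_nonneg _), tr_eq_hsNormSq (opSqrt_nonneg _), fidelity, fidelity,
    tr_eq_hsNormSq (opSqrt_nonneg (opSqrt A * A' * opSqrt A)),
    tr_eq_hsNormSq (opSqrt_nonneg (opSqrt B * B' * opSqrt B)), ← Complex.ofReal_mul]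
  simp only [Complex.ofReal_re]

end Tensor

/-! ### Finite tensor products and tensor powers. -/

section TensorOp

variable {X : Type}

theorem ket_pi {n : ℕ} (f f' : Fin n → X) : ket f' f = ∏ s, ket (f' s) (f s) := by
  classical
  simp only [ket_apply, Finset.prod_ite_zero, Finset.prod_const_one, funext_iff, Finset.mem_univ,
    true_implies]

theorem localOp_apply {n : ℕ} (s : Fin n) (A : Op X) (ψ : H (Fin n → X)) (f : Fin n → X) :
    localOp s A ψ f = A (slice s ψ f) (f s) := rfl

/-- Arbitrary lists of distinct sites allow peeling off one site `s` at a time: the remaining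
factors do not act on `s`, so the slice there is still a multiple of the original basis vector. -/
theorem list_prod_localOp_entry {n : ℕ} (A : Fin n → Op X) (l : List (Fin n)) (hl : l.Nodup)
    (f f' : Fin n → X) :
    (l.map fun s => localOp s (A s)).prod (ket f') f =
      ∏ s, (if s ∈ l then A s else 1) (ket (f' s)) (f s) := by
  induction l generalizing f with
  | nil => simpa using ket_pi f f'
  | cons s l ih =>
    rw [List.nodup_cons] at hl
    set ψ := (l.map fun s => localOp s (A s)).prod (ket f') with hψ
    have h : slice s ψ f = (∏ t ∈ Finset.univ.erase s,
        (if t ∈ s :: l then A t else 1) (ket (f' t)) (f t)) • ket (f' s) := by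
      ext x
      change ψ (Function.update f s x) = _ * _
      rw [hψ, ih hl.2, ← Finset.mul_prod_erase _ _ (Finset.mem_univ s), if_neg hl.1, mul_comm]
      congr 1
      · refine Finset.prod_congr rfl fun t ht => ?_
        have hts := Finset.ne_of_mem_erase ht
        simp [hts]
      · simp
    rw [List.map_cons, List.prod_cons]
    change localOp s (A s) ψ f = _
    rw [localOp_apply, h, ← Finset.mul_prod_erase _ _ (Finset.mem_univ s), if_pos List.mem_cons_self,
      map_smul, mul_comm]
    rfl

theorem tensorOp_entry {n : ℕ} (A : Fin n → Op X) (f f' : Fin n → X) :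
    tensorOp A (ket f') f = ∏ s, A s (ket (f' s)) (f s) := by
  rw [tensorOp, List.ofFn_eq_map, list_prod_localOp_entry A _ (List.nodup_finRange n)]
  simp

theorem isTensor_tensorOp_succ {n : ℕ} (A : Fin (n + 1) → Op X) :
    IsTensor (Fin.consEquiv fun _ => X).symm (A 0) (tensorOp fun s => A s.succ) (tensorOp A) :=
  fun f f' => by
    rw [tensorOp_entry, tensorOp_entry, Fin.prod_univ_succ]
    rfl

/-- The zeroth tensor power lives on a one-dimensional space; this starts the inductions over
copies. -/
theorem isDensity_one_of_unique [Unique X] : IsDensity (1 : Op X) := by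
  refine ⟨zero_le_one, ?_⟩
  have := hasSum_unique fun x : X => (1 : Op X) (ket x) x
  have e1 : (1 : Op X) (ket default) default = 1 := by
    classical
    change ket default default = 1
    rw [ket_apply, if_pos rfl]
  rwa [e1] at this

theorem tensorPow_zero (ρ : Op X) : tensorPow 0 ρ = 1 := by
  simp [tensorPow, tensorOp]

theorem isDensity_tensorPow {ρ : Op X} (hρ : IsDensity ρ) (M : ℕ) : IsDensity (tensorPow M ρ) := by
  induction M with
  | zero => rw [tensorPow_zero]; exact isDensity_one_of_unique
  | succ M ih => exact (isTensor_tensorOp_succ fun _ => ρ).isDensity hρ ih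

theorem fidelity_tensorPow {ρ σ : Op X} (hρ : IsDensity ρ) (hσ : IsDensity σ) (M : ℕ) :
    fidelity (tensorPow M ρ) (tensorPow M σ) = fidelity ρ σ ^ M := by
  induction M with
  | zero => rw [tensorPow_zero, tensorPow_zero, pow_zero, fidelity_self isDensity_one_of_unique]
  | succ M ih =>
    rw [pow_succ', ← ih]
    exact (isTensor_tensorOp_succ fun _ => ρ).fidelity_eq (isTensor_tensorOp_succ fun _ => σ)
      hρ (isDensity_tensorPow hρ M) hσ (isDensity_tensorPow hσ M)

end TensorOp

/-! ### Kraus families -/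

section SumLemmas

variable {α β : Type}

theorem hasSum_prod_of_nonneg {f : α × β → ℝ} (h0 : ∀ p, 0 ≤ f p) {g : α → ℝ} {c : ℝ}
    (hf : ∀ a, HasSum (fun b => f (a, b)) (g a)) (hg : HasSum g c) : HasSum f c := by
  have hs : Summable f := (summable_prod_of_nonneg h0).2
    ⟨fun a => (hf a).summable, hg.summable.congr fun a => (hf a).tsum_eq.symm⟩
  rw [hs.hasSum_iff, hs.tsum_prod, tsum_congr fun a => (hf a).tsum_eq, hg.tsum_eq]

theorem hasSum_comm_of_nonneg {f : α → β → ℝ} (h0 : ∀ a b, 0 ≤ f a b) {g : α → ℝ} {h : β → ℝ}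
    {c : ℝ} (hf : ∀ a, HasSum (f a) (g a)) (hg : HasSum g c)
    (hh : ∀ b, HasSum (fun a => f a b) (h b)) : HasSum h c := by
  have := hasSum_prod_of_nonneg (f := fun p : α × β => f p.1 p.2) (fun p => h0 _ _) hf hg
  exact ((Equiv.prodComm β α).hasSum_iff.2 this).prod_fiberwise hh

end SumLemmas

/-! ### Kraus sums applied to pure states. -/

section Kraus

variable {X Y Z ι ι₁ ι₂ : Type}

theorem comp_pureState_comp_adjoint (K : Op X) (v : H X) :
    K * pureState v * star K = pureState (K v) := by
  ext1 x
  change K (inner ℂ v ((K†) x) • v) = inner ℂ (K v) x • K v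
  rw [map_smul, ContinuousLinearMap.adjoint_inner_right]

theorem pureState_apply_ket (w : H X) (x y : X) : pureState w (ket y) x = w x * star (w y) := by
  change (inner ℂ w (ket y) • w : H X) x = _
  rw [inner_ket_right, mul_comm]
  rfl

theorem pureState_nonneg (w : H X) : 0 ≤ pureState w := by
  rw [ContinuousLinearMap.nonneg_iff_isPositive, ContinuousLinearMap.isPositive_iff_complex]
  intro x
  have h : inner ℂ (pureState w x) x = ((‖inner ℂ w x‖ ^ 2 : ℝ) : ℂ) := by
    change inner ℂ (inner ℂ w x • w) x = _
    rw [inner_smul_left, RCLike.conj_mul, Complex.ofReal_pow]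
    rfl
  rw [h]
  exact ⟨rfl, by rw [RCLike.re_to_complex, Complex.ofReal_re]; positivity⟩

/-- On a pure state the terms are rank-one operators of norm `‖Kₖ v‖²`. The series thus converges
absolutely in operator norm, and the `tsum` in `krausMap` is its actual sum. -/
theorem hasSum_krausMap {K : ι → Op X} {v : H X} (h : Summable fun k => ‖K k v‖ ^ 2) :
    HasSum (fun k => pureState (K k v)) (krausMap K (pureState v)) := by
  have hs : Summable fun k => pureState (K k v) := by
    refine Summable.of_norm (h.congr fun k => ?_)
    rw [pureState, InnerProductSpace.norm_rankOne, sq]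
  simpa only [krausMap, comp_pureState_comp_adjoint] using hs.hasSum

theorem krausMap_entry {K : ι → Op X} {v : H X} (h : Summable fun k => ‖K k v‖ ^ 2) (x y : X) :
    HasSum (fun k => K k v x * star (K k v y)) (krausMap K (pureState v) (ket y) x) := by
  have h1 := (hasSum_krausMap h).mapL
    ((innerSL ℂ (ket x)) ∘L (ContinuousLinearMap.apply ℂ (H X) (ket y)))
  simpa [inner_ket_left, pureState_apply_ket] using h1

/-- The trace is obtained by exchanging the sums over Kraus index and basis label, all terms `|(Kₖ
v)(x)|²` being nonnegative. -/
theorem isDensity_krausMap {K : ι → Op X} {v : H X} (h : HasSum (fun k => ‖K k v‖ ^ 2) 1) :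
    IsDensity (krausMap K (pureState v)) := by
  refine ⟨(hasSum_krausMap h.summable).nonneg fun k => pureState_nonneg _, ?_⟩
  have hk : ∀ k, HasSum (fun x => ‖K k v x‖ ^ 2) (‖K k v‖ ^ 2) := fun k => hasSum_norm_sq _
  have hx : ∀ x, ∃ r : ℝ, HasSum (fun k => ‖K k v x‖ ^ 2) r ∧
      krausMap K (pureState v) (ket x) x = r := by
    intro x
    have h1 := krausMap_entry h.summable x x
    have h2 : ∀ k, K k v x * star (K k v x) = ((‖K k v x‖ ^ 2 : ℝ) : ℂ) := fun k => by
      rw [RCLike.star_def, RCLike.mul_conj, Complex.ofReal_pow]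
      rfl
    simp only [h2] at h1
    have h3 : Summable fun k => ‖K k v x‖ ^ 2 := by exact_mod_cast h1.summable
    exact ⟨_, h3.hasSum, h1.unique (by exact_mod_cast h3.hasSum)⟩
  choose r hr hr' using hx
  have := hasSum_comm_of_nonneg (fun k x => by positivity) hk h hr
  simp only [hr']
  simpa using Complex.hasSum_ofReal.2 this

/-- Each matrix element of the output is a series over the Kraus index. On a product vector its
terms factor, and both factor series converge absolutely because their terms are at most `‖Kₖ v‖²`.
-/
theorem isTensor_krausMap {e : Z ≃ X × Y} (eι : ι ≃ ι₁ × ι₂) {K : ι → Op Z} {K₁ : ι₁ → Op X}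
    {K₂ : ι₂ → Op Y} (hK : ∀ k, IsTensor e (K₁ (eι k).1) (K₂ (eι k).2) (K k)) {v : H Z}
    {v₁ : H X} {v₂ : H Y} (hv : ∀ z, v z = v₁ (e z).1 * v₂ (e z).2)
    (h : Summable fun k => ‖K k v‖ ^ 2) (h₁ : Summable fun k => ‖K₁ k v₁‖ ^ 2)
    (h₂ : Summable fun k => ‖K₂ k v₂‖ ^ 2) :
    IsTensor e (krausMap K₁ (pureState v₁)) (krausMap K₂ (pureState v₂))
      (krausMap K (pureState v)) := by
  intro z z'
  have bound : ∀ {W κ : Type} {L : κ → Op W} {u : H W}, (Summable fun k => ‖L k u‖ ^ 2) →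
      ∀ x y, Summable fun k => ‖L k u x * star (L k u y)‖ := by
    intro W κ L u hu x y
    refine Summable.of_nonneg_of_le (fun _ => norm_nonneg _) (fun k => ?_) hu
    rw [norm_mul, norm_star, sq]
    exact mul_le_mul (lp.norm_apply_le_norm two_ne_zero _ _)
      (lp.norm_apply_le_norm two_ne_zero _ _) (norm_nonneg _) (norm_nonneg _)
  have a₁ := krausMap_entry h₁ (e z).1 (e z').1
  have a₂ := krausMap_entry h₂ (e z).2 (e z').2
  have hs := summable_mul_of_summable_norm (bound h₁ (e z).1 (e z').1) (bound h₂ (e z).2 (e z').2)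
  have a := eι.hasSum_iff.2 (a₁.mul a₂ hs)
  refine (krausMap_entry h z z').unique ?_
  refine (congrArg (HasSum · _) (funext fun k => ?_)).mpr a
  simp only [Function.comp, (hK k).apply_prod hv, star_mul']
  ring

/-- Kraus families with `∑ₖ Kₖ† Kₖ = 1`. -/
def IsComplete (K : ι → Op X) : Prop := ∀ v, HasSum (fun k => ‖K k v‖ ^ 2) (‖v‖ ^ 2)

theorem IsComplete.amplify {K : ι → Op X} (hK : IsComplete K) (e : Z ≃ X × Y) :
    IsComplete fun k => amplify e (K k) := fun ψ =>
  hasSum_comm_of_nonneg (f := fun y k => ‖K k (sliceAt e y ψ)‖ ^ 2) (fun _ _ => by positivity)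
    (fun y => hK (sliceAt e y ψ)) (hasSum_norm_sq_sliceAt e ψ)
    (fun k => hasSum_norm_sq_amplify e (K k) ψ)

theorem IsComplete.comp {K₁ : ι₁ → Op X} {K₂ : ι₂ → Op X} (h₁ : IsComplete K₁)
    (h₂ : IsComplete K₂) (eι : ι ≃ ι₁ × ι₂) :
    IsComplete fun k => K₁ (eι k).1 ∘L K₂ (eι k).2 := fun ψ => by
  have := hasSum_prod_of_nonneg (f := fun p : ι₂ × ι₁ => ‖K₁ p.2 (K₂ p.1 ψ)‖ ^ 2)
    (fun _ => by positivity) (fun k => h₁ (K₂ k ψ)) (h₂ ψ)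
  exact (eι.trans (Equiv.prodComm ι₁ ι₂)).hasSum_iff.2 this

/-- The family is the composition of `K₁ ⊗ 1` and `1 ⊗ K₂`, each complete by summing over slices. -/
theorem IsComplete.tensor {e : Z ≃ X × Y} (eι : ι ≃ ι₁ × ι₂) {K : ι → Op Z} {K₁ : ι₁ → Op X}
    {K₂ : ι₂ → Op Y} (hK : ∀ k, IsTensor e (K₁ (eι k).1) (K₂ (eι k).2) (K k))
    (h₁ : IsComplete K₁) (h₂ : IsComplete K₂) : IsComplete K := by
  have := (h₁.amplify e).comp (h₂.amplify (e.trans (Equiv.prodComm X Y))) eι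
  simpa only [← (hK _).eq_amplify_comp] using this

end Kraus

/-! ### Product channels -/

section Product

variable {X : Type}

theorem isComplete_kraus (E : Channel) : IsComplete E.kraus := E.complete

/-- The Kraus operators of a product channel. -/
def productKraus {n : ℕ} (E : Fin n → Channel) (κ : Fin n → ℕ) : Op (Fin n → ℕ) :=
  tensorOp fun s => (E s).kraus (κ s)

theorem isComplete_productKraus {n : ℕ} (E : Fin n → Channel) : IsComplete (productKraus E) := by
  induction n with
  | zero =>
    intro v
    have : ∀ κ, productKraus E κ = 1 := fun κ => by simp [productKraus, tensorOp]
    simp only [this]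
    exact hasSum_unique fun _ : Fin 0 → ℕ => ‖v‖ ^ 2
  | succ n ih =>
    exact IsComplete.tensor (Fin.consEquiv fun _ => ℕ).symm (K₁ := (E 0).kraus)
      (K₂ := productKraus fun s => E s.succ)
      (fun κ => isTensor_tensorOp_succ fun s => (E s).kraus (κ s)) (isComplete_kraus _) (ih _)

theorem isDensity_productChannel {n : ℕ} (E : Fin n → Channel) {v : H (Fin n → ℕ)}
    (hv : ‖v‖ = 1) : IsDensity (productChannel E (pureState v)) :=
  isDensity_krausMap (K := productKraus E) (by simpa [hv] using isComplete_productKraus E v)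

theorem isDensity_apply (E : Channel) {v : H ℕ} (hv : ‖v‖ = 1) :
    IsDensity (E.apply (pureState v)) :=
  isDensity_krausMap (by simpa [hv] using E.complete v)

/-- Splitting the labels of `n` factors into two groups. -/
def splitLabels (X : Type) {a b n : ℕ} (e : Fin a ⊕ Fin b ≃ Fin n) :
    (Fin n → X) ≃ (Fin a → X) × (Fin b → X) :=
  (Equiv.arrowCongr e.symm (Equiv.refl X)).trans (Equiv.sumArrowEquivProdArrow _ _ _)

theorem splitLabels_snd {a b n : ℕ} (e : Fin a ⊕ Fin b ≃ Fin n) (f : Fin n → X) (s : Fin b) :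
    (splitLabels X e f).2 s = f (e (Sum.inr s)) := rfl

theorem isTensor_tensorOp_split {a b n : ℕ} (e : Fin a ⊕ Fin b ≃ Fin n) (A : Fin n → Op X) :
    IsTensor (splitLabels X e) (tensorOp fun s => A (e (Sum.inl s)))
      (tensorOp fun s => A (e (Sum.inr s))) (tensorOp A) := fun f f' => by
  rw [tensorOp_entry, tensorOp_entry, tensorOp_entry, ← e.prod_comp, Fintype.prod_sum_type]
  rfl

theorem isTensor_productChannel {a b n : ℕ} (e : Fin a ⊕ Fin b ≃ Fin n) (E : Fin n → Channel)
    {v : H (Fin n → ℕ)} {v₁ : H (Fin a → ℕ)} {v₂ : H (Fin b → ℕ)}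
    (hv : ∀ f, v f = v₁ (splitLabels ℕ e f).1 * v₂ (splitLabels ℕ e f).2) :
    IsTensor (splitLabels ℕ e) (productChannel (fun s => E (e (Sum.inl s))) (pureState v₁))
      (productChannel (fun s => E (e (Sum.inr s))) (pureState v₂))
      (productChannel E (pureState v)) :=
  isTensor_krausMap (splitLabels ℕ e) (K := productKraus E)
    (K₁ := productKraus fun s => E (e (Sum.inl s))) (K₂ := productKraus fun s => E (e (Sum.inr s)))
    (fun κ => isTensor_tensorOp_split e fun s => (E s).kraus (κ s)) hv
    (isComplete_productKraus E v).summable (isComplete_productKraus _ v₁).summable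
    (isComplete_productKraus _ v₂).summable

/-- Splitting one label off. -/
def splitOption (X : Type) {b n : ℕ} (e : Option (Fin b) ≃ Fin n) :
    (Fin n → X) ≃ X × (Fin b → X) :=
  (Equiv.arrowCongr e.symm (Equiv.refl X)).trans (Equiv.piOptionEquivProd (β := fun _ => X))

theorem splitOption_snd {b n : ℕ} (e : Option (Fin b) ≃ Fin n) (f : Fin n → X) (s : Fin b) :
    (splitOption X e f).2 s = f (e (some s)) := rfl

theorem isTensor_tensorOp_splitOption {b n : ℕ} (e : Option (Fin b) ≃ Fin n) (A : Fin n → Op X) :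
    IsTensor (splitOption X e) (A (e none)) (tensorOp fun s => A (e (some s))) (tensorOp A) :=
  fun f f' => by
    rw [tensorOp_entry, tensorOp_entry, ← e.prod_comp, Fintype.prod_option]
    rfl

theorem isTensor_productChannel_option {b n : ℕ} (e : Option (Fin b) ≃ Fin n)
    (E : Fin n → Channel) {v : H (Fin n → ℕ)} {v₁ : H ℕ} {v₂ : H (Fin b → ℕ)}
    (hv : ∀ f, v f = v₁ (splitOption ℕ e f).1 * v₂ (splitOption ℕ e f).2) :
    IsTensor (splitOption ℕ e) ((E (e none)).apply (pureState v₁))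
      (productChannel (fun s => E (e (some s))) (pureState v₂))
      (productChannel E (pureState v)) :=
  isTensor_krausMap (splitOption ℕ e) (K := productKraus E)
    (K₁ := (E (e none)).kraus) (K₂ := productKraus fun s => E (e (some s)))
    (fun κ => isTensor_tensorOp_splitOption e fun s => (E s).kraus (κ s)) hv
    (isComplete_productKraus E v).summable ((E (e none)).complete v₁).summable
    (isComplete_productKraus _ v₂).summable

end Product

/-! ### Probe states -/

section Probes

theorem norm_eq_one_of_hasSum {X : Type} {v : H X} (h : HasSum (fun x => ‖v x‖ ^ 2) 1) :
    ‖v‖ = 1 := by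
  have := (hasSum_norm_sq v).unique h
  exact (pow_eq_one_iff_of_nonneg (norm_nonneg v) two_ne_zero).1 this

theorem norm_tmsvVec (N : ℝ≥0) : ‖tmsvVec N‖ = 1 :=
  norm_eq_one_of_hasSum ((finTwoArrowEquiv ℕ).hasSum_iff.2 (tmsvAmp_hasSum N))

theorem norm_coherentVec (α : ℂ) : ‖coherentVec α‖ = 1 :=
  norm_eq_one_of_hasSum (coherentAmp_hasSum α)

theorem evenProbe_apply (N : ℝ≥0) {m k : ℕ} (e : Fin k × Fin 2 ≃ Fin m) (n : Fin m → ℕ) :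
    evenProbe N e n = ∏ j, tmsvVec N fun s => n (e (j, s)) := rfl

theorem hybridProbe_apply (N : ℝ≥0) (α : ℂ) {m k : ℕ} (e : Option (Fin k × Fin 2) ≃ Fin m)
    (n : Fin m → ℕ) : hybridProbe N α e n =
      (∏ j, tmsvVec N fun s => n (e (some (j, s)))) * coherentVec α (n (e none)) := rfl

theorem idlerProbe_apply (N : ℝ≥0) {m k : ℕ} (e : Option (Fin k × Fin 2) ≃ Fin m)
    (n : Fin (m + 1) → ℕ) : idlerProbe N e n =
      (∏ j, tmsvVec N fun s => n (e (some (j, s))).castSucc) *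
        tmsvVec N ![n (e none).castSucc, n (Fin.last m)] := rfl

theorem evenProbe_zero_apply (N : ℝ≥0) {m : ℕ} (e : Fin 0 × Fin 2 ≃ Fin m) (n : Fin m → ℕ) :
    evenProbe N e n = 1 := by
  simp [evenProbe_apply]

theorem norm_evenProbe_zero (N : ℝ≥0) {m : ℕ} (e : Fin 0 × Fin 2 ≃ Fin m) :
    ‖evenProbe N e‖ = 1 := by
  have : IsEmpty (Fin m) := e.symm.isEmpty
  refine norm_eq_one_of_hasSum ?_
  simp only [evenProbe_zero_apply, norm_one, one_pow]
  exact hasSum_unique fun _ : Fin m → ℕ => (1 : ℝ)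

theorem tmsvVec_swap (N : ℝ≥0) (a b : ℕ) : tmsvVec N ![a, b] = tmsvVec N ![b, a] := by
  change tmsvAmp N a b = tmsvAmp N b a
  unfold tmsvAmp
  by_cases h : a = b
  · rw [h]
  · rw [if_neg h, if_neg (Ne.symm h)]

theorem tmsvVec_eta (N : ℝ≥0) (n : Fin 2 → ℕ) : tmsvVec N n = tmsvVec N ![n 0, n 1] := rfl

end Probes

/-! ### Outputs of product probes -/

section Outputs

variable (E : Bool → Channel) (N : ℝ≥0)

theorem isDensity_patternOutput {m : ℕ} (i : Pattern m) {v : H (Fin m → ℕ)} (hv : ‖v‖ = 1) :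
    IsDensity (patternOutput E i v) := isDensity_productChannel _ hv

theorem isDensity_pair (i : Pattern 2) : IsDensity (patternOutput E i (tmsvVec N)) :=
  isDensity_patternOutput E i (norm_tmsvVec N)

theorem pairFidelity_comm (i i' : Pattern 2) : pairFidelity E N i i' = pairFidelity E N i' i :=
  fidelity_comm (isDensity_pair E N i) (isDensity_pair E N i')

theorem pairFidelity_self (i : Pattern 2) : pairFidelity E N i i = 1 :=
  fidelity_self (isDensity_pair E N i)

theorem pairFidelity_swap (a b c d : Bool) :
    pairFidelity E N ![a, b] ![c, d] = pairFidelity E N ![b, a] ![d, c] := by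
  let e₀ : Fin 0 × Fin 2 ≃ Fin 0 := Equiv.equivOfIsEmpty _ _
  -- Exchanging the two modes is encoded as a splitting of two labels into two permuted ones and
  -- none. The empty block contributes fidelity one, and the squeezed vacuum is symmetric, so the
  -- splitting lemma for product channels gives the claim.
  let e : Fin 2 ⊕ Fin 0 ≃ Fin 2 := (Equiv.sumEmpty (Fin 2) (Fin 0)).trans (Equiv.swap 0 1)
  have hv : ∀ f, tmsvVec N f =
      tmsvVec N (splitLabels ℕ e f).1 * evenProbe N e₀ (splitLabels ℕ e f).2 := fun f => by
    rw [evenProbe_zero_apply, mul_one, tmsvVec_eta, tmsvVec_swap, tmsvVec_eta N (_ : Fin 2 → ℕ)]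
    rfl
  have h : ∀ i : Pattern 2, IsTensor (splitLabels ℕ e) (patternOutput E ![i 1, i 0] (tmsvVec N))
      (patternOutput E ![] (evenProbe N e₀)) (patternOutput E i (tmsvVec N)) := fun i => by
    convert isTensor_productChannel e (fun s => E (i s)) hv using 1
    · unfold patternOutput
      congr 1
      funext s
      fin_cases s <;> rfl
    · unfold patternOutput
      congr 1
      funext s
      exact s.elim0
    · rfl
  have hE := isDensity_patternOutput E ![] (norm_evenProbe_zero N e₀)
  have := (h ![a, b]).fidelity_eq (h ![c, d]) (isDensity_pair E N _) hE (isDensity_pair E N _) hE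
  rw [fidelity_self hE, mul_one] at this
  exact this

theorem sum_pattern_two {f : Pattern 2 → ℝ} :
    ∑ i, f i = f ![true, true] + f ![true, false] + (f ![false, true] + f ![false, false]) := by
  rw [← (finTwoArrowEquiv Bool).symm.sum_comp, Fintype.sum_prod_type]
  simp [finTwoArrowEquiv]

theorem pattern_two_cases (i : Pattern 2) : i = ![false, false] ∨ i = ![false, true] ∨
    i = ![true, false] ∨ i = ![true, true] := by
  revert i
  decide

/-- Among the 16 ordered pairs, 4 are diagonal, `F01` and `F12` occur 4 times each, and `F11` and
`F02` twice each. -/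
theorem sum_pairFidelity_pow (K : ℕ) :
    ∑ i, ∑ i', pairFidelity E N i i' ^ K = 4 * D2 E N K := by
  have h1 : pairFidelity E N ![false, false] ![true, false] = F01 E N := pairFidelity_swap ..
  have h2 : pairFidelity E N ![true, false] ![true, true] = F12 E N := pairFidelity_swap ..
  simp only [sum_pattern_two, pairFidelity_self, D2]
  rw [pairFidelity_comm E N ![true, true] ![true, false],
    pairFidelity_comm E N ![true, true] ![false, true],
    pairFidelity_comm E N ![true, true] ![false, false],
    pairFidelity_comm E N ![true, false] ![false, false],
    pairFidelity_comm E N ![false, true] ![true, false],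
    pairFidelity_comm E N ![false, true] ![false, false], h1, h2]
  change _ + F12 E N ^ K + (F12 E N ^ K + F02 E N ^ K) + (_ + _ + (F11 E N ^ K + F01 E N ^ K)) +
    (F12 E N ^ K + F11 E N ^ K + (_ + F01 E N ^ K) + (F02 E N ^ K + _ + (F01 E N ^ K + _))) = _
  ring

theorem pairFidelity_targets (i i' : Pattern 2) :
    (targets i = 0 → targets i' = 1 → pairFidelity E N i i' = F01 E N) ∧
    (targets i = 1 → targets i' = 2 → pairFidelity E N i i' = F12 E N) ∧
    (targets i = 1 → targets i' = 1 → i ≠ i' → pairFidelity E N i i' = F11 E N) ∧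
    (targets i = 0 → targets i' = 2 → pairFidelity E N i i' = F02 E N) := by
  have h1 : pairFidelity E N ![false, false] ![true, false] = F01 E N := pairFidelity_swap ..
  have h2 : pairFidelity E N ![true, false] ![true, true] = F12 E N := pairFidelity_swap ..
  have h3 : pairFidelity E N ![false, true] ![true, false] = F11 E N := pairFidelity_swap ..
  have t0 : targets ![false, false] = 0 := by decide
  have t1 : targets ![false, true] = 1 := by decide
  have t1' : targets ![true, false] = 1 := by decide
  have t2 : targets ![true, true] = 2 := by decide
  rcases pattern_two_cases i with rfl | rfl | rfl | rfl <;>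
    rcases pattern_two_cases i' with rfl | rfl | rfl | rfl <;>
    simp [t0, t1, t1', t2, h1, h2, h3, F01, F12, F11, F02]

/-- This factorisation needs the full double sum, diagonal included; the diagonal is removed only at
the end. -/
theorem sum_sum_split {Z A B : Type} [Fintype Z] [Fintype A] [Fintype B] (e : Z ≃ A × B)
    {f : Z → Z → ℝ} {g : A → A → ℝ} {h : B → B → ℝ}
    (hf : ∀ z z', f z z' = g (e z).1 (e z').1 * h (e z).2 (e z').2) :
    ∑ z, ∑ z', f z z' = (∑ a, ∑ a', g a a') * ∑ b, ∑ b', h b b' := by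
  simp only [hf]
  rw [← e.symm.sum_comp]
  simp only [Equiv.apply_symm_apply]
  have : ∀ p : A × B, ∑ z', g p.1 (e z').1 * h p.2 (e z').2 =
      (∑ a', g p.1 a') * ∑ b', h p.2 b' := fun p => by
    rw [← e.symm.sum_comp]
    simp only [Equiv.apply_symm_apply, Fintype.sum_prod_type, Finset.sum_mul_sum]
  simp only [this, Fintype.sum_prod_type, Finset.sum_mul_sum]

/-- The first pair of modes and the other ones. -/
def firstPair {k m : ℕ} (e : Fin (k + 1) × Fin 2 ≃ Fin m) : Fin 2 ⊕ Fin (k * 2) ≃ Fin m :=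
  Equiv.trans
    { toFun := Sum.elim (fun s => (0, s))
        fun t => ((finProdFinEquiv.symm t).1.succ, (finProdFinEquiv.symm t).2)
      invFun := fun p => Fin.cases (Sum.inl p.2) (fun j => Sum.inr (finProdFinEquiv (j, p.2))) p.1
      left_inv := by
        rintro (s | t)
        · rfl
        · change Sum.inr (finProdFinEquiv (finProdFinEquiv.symm t)) = _
          rw [Equiv.apply_symm_apply]
      right_inv := by
        rintro ⟨j, s⟩
        refine Fin.cases ?_ (fun j => ?_) j
        · rfl
        · change ((finProdFinEquiv.symm (finProdFinEquiv (j, s))).1.succ,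
            (finProdFinEquiv.symm (finProdFinEquiv (j, s))).2) = _
          rw [Equiv.symm_apply_apply] } e

theorem firstPair_inr {k m : ℕ} (e : Fin (k + 1) × Fin 2 ≃ Fin m) (j : Fin k) (s : Fin 2) :
    firstPair e (Sum.inr (finProdFinEquiv (j, s))) = e (j.succ, s) := by
  change e ((finProdFinEquiv.symm (finProdFinEquiv (j, s))).1.succ,
    (finProdFinEquiv.symm (finProdFinEquiv (j, s))).2) = _
  rw [Equiv.symm_apply_apply]

/-- The output states of a product of two-mode squeezed vacua are states, and the powers of their
fidelities sum up to a power of `D₂`. -/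
theorem evenProbe_output (K k : ℕ) : ∀ {m : ℕ} (e : Fin k × Fin 2 ≃ Fin m),
    (∀ i, IsDensity (patternOutput E i (evenProbe N e))) ∧
    ∑ i, ∑ i', fidelity (patternOutput E i (evenProbe N e))
      (patternOutput E i' (evenProbe N e)) ^ K = (4 * D2 E N K) ^ k := by
  induction k with
  | zero =>
    intro m e
    have : IsEmpty (Fin m) := e.symm.isEmpty
    have h := fun i => isDensity_patternOutput E i (norm_evenProbe_zero N e)
    refine ⟨h, ?_⟩
    rw [Fintype.sum_unique, Fintype.sum_unique, fidelity_self (h _), one_pow, pow_zero]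
  | succ k ih =>
    intro m e
    -- The induction hypothesis covers every labelling of the modes, so the remaining pairs may be
    -- renumbered in the standard way.
    obtain ⟨ih1, ih2⟩ := ih (m := k * 2) finProdFinEquiv
    have hv : ∀ f, evenProbe N e f = tmsvVec N (splitLabels ℕ (firstPair e) f).1 *
        evenProbe N finProdFinEquiv (splitLabels ℕ (firstPair e) f).2 := fun f => by
      rw [evenProbe_apply, evenProbe_apply, Fin.prod_univ_succ]
      simp only [splitLabels_snd, firstPair_inr]
      rfl
    have ht : ∀ i : Pattern m, IsTensor (splitLabels ℕ (firstPair e))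
        (patternOutput E (splitLabels Bool (firstPair e) i).1 (tmsvVec N))
        (patternOutput E (splitLabels Bool (firstPair e) i).2 (evenProbe N finProdFinEquiv))
        (patternOutput E i (evenProbe N e)) := fun i =>
      isTensor_productChannel (firstPair e) (fun s => E (i s)) hv
    refine ⟨fun i => (ht i).isDensity (isDensity_pair E N _) (ih1 _), ?_⟩
    rw [pow_succ', ← ih2, ← sum_pairFidelity_pow E N]
    refine sum_sum_split (splitLabels Bool (firstPair e)) fun i i' => ?_
    rw [← mul_pow, (ht i).fidelity_eq (ht i') (isDensity_pair E N _) (ih1 _)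
      (isDensity_pair E N _) (ih1 _)]
    rfl

/-- The remaining mode and the pairs of modes. -/
def numberPairs {k m : ℕ} (e : Option (Fin k × Fin 2) ≃ Fin m) : Option (Fin (k * 2)) ≃ Fin m :=
  (Equiv.optionCongr finProdFinEquiv.symm).trans e

theorem numberPairs_some {k m : ℕ} (e : Option (Fin k × Fin 2) ≃ Fin m) (j : Fin k) (s : Fin 2) :
    numberPairs e (some (finProdFinEquiv (j, s))) = e (some (j, s)) := by
  change e (some (finProdFinEquiv.symm (finProdFinEquiv (j, s)))) = _
  rw [Equiv.symm_apply_apply]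

theorem sum_bool_fidelity {X : Type} {ρ : Bool → Op X} (h : ∀ b, IsDensity (ρ b)) (K : ℕ) :
    ∑ b, ∑ b', fidelity (ρ b) (ρ b') ^ K = 2 * (1 + fidelity (ρ false) (ρ true) ^ K) := by
  simp only [Fintype.sum_bool, fidelity_self (h _), one_pow]
  rw [fidelity_comm (h true) (h false)]
  ring

theorem hybridProbe_output (α : ℂ) (K k : ℕ) {m : ℕ} (e : Option (Fin k × Fin 2) ≃ Fin m) :
    (∀ i, IsDensity (patternOutput E i (hybridProbe N α e))) ∧
    ∑ i, ∑ i', fidelity (patternOutput E i (hybridProbe N α e))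
      (patternOutput E i' (hybridProbe N α e)) ^ K =
        2 * (1 + Fcl E α ^ K) * (4 * D2 E N K) ^ k := by
  obtain ⟨h1, h2⟩ := evenProbe_output E N K k (m := k * 2) finProdFinEquiv
  have h0 : ∀ b, IsDensity ((E b).apply (pureState (coherentVec α))) := fun b =>
    isDensity_apply _ (norm_coherentVec α)
  have hv : ∀ f, hybridProbe N α e f = coherentVec α (splitOption ℕ (numberPairs e) f).1 *
      evenProbe N finProdFinEquiv (splitOption ℕ (numberPairs e) f).2 := fun f => by
    rw [hybridProbe_apply, evenProbe_apply, mul_comm]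
    simp only [splitOption_snd, numberPairs_some]
    rfl
  have ht : ∀ i : Pattern m, IsTensor (splitOption ℕ (numberPairs e))
      ((E (splitOption Bool (numberPairs e) i).1).apply (pureState (coherentVec α)))
      (patternOutput E (splitOption Bool (numberPairs e) i).2 (evenProbe N finProdFinEquiv))
      (patternOutput E i (hybridProbe N α e)) := fun i =>
    isTensor_productChannel_option (numberPairs e) (fun s => E (i s)) hv
  refine ⟨fun i => (ht i).isDensity (h0 _) (h1 _), ?_⟩
  rw [Fcl, ← sum_bool_fidelity h0 K, ← h2]
  refine sum_sum_split (splitOption Bool (numberPairs e)) fun i i' => ?_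
  rw [← mul_pow, (ht i).fidelity_eq (ht i') (h0 _) (h1 _) (h0 _) (h1 _)]

/-- The remaining mode with the idler and the pairs of modes. -/
def idlerPairs {k m : ℕ} (e : Option (Fin k × Fin 2) ≃ Fin m) :
    Fin 2 ⊕ Fin (k * 2) ≃ Fin (m + 1) where
  toFun := Sum.elim ![(e none).castSucc, Fin.last m]
    fun t => (numberPairs e (some t)).castSucc
  invFun := Fin.lastCases (Sum.inl 1) fun t =>
    ((numberPairs e).symm t).elim (Sum.inl 0) Sum.inr
  left_inv := by
    rintro (s | t)
    · fin_cases s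
      · have : (numberPairs e).symm (e none) = none := (numberPairs e).symm_apply_eq.2 rfl
        simp [this]
      · simp
    · simp
  right_inv := by
    intro t
    refine Fin.lastCases ?_ (fun t => ?_) t
    · simp
    · obtain ⟨o, rfl⟩ := (numberPairs e).surjective t
      rcases o with _ | t
      · beta_reduce
        rw [Fin.lastCases_castSucc, Equiv.symm_apply_apply]
        rfl
      · simp

theorem idlerPairs_inr {k m : ℕ} (e : Option (Fin k × Fin 2) ≃ Fin m) (t : Fin (k * 2)) :
    idlerPairs e (Sum.inr t) = (numberPairs e (some t)).castSucc := rfl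

/-- States and patterns are split differently: the states along a block of two labels, the remaining
mode and the idler, but the patterns along the single letter of that mode, since the idler carries
the fixed channel `Channel.id`. -/
theorem idlerProbe_output (K k : ℕ) {m : ℕ} (e : Option (Fin k × Fin 2) ≃ Fin m) :
    (∀ i, IsDensity (patternOutputIdler E i (idlerProbe N e))) ∧
    ∑ i, ∑ i', fidelity (patternOutputIdler E i (idlerProbe N e))
      (patternOutputIdler E i' (idlerProbe N e)) ^ K =
        2 * (1 + Fchoi E N ^ K) * (4 * D2 E N K) ^ k := by
  obtain ⟨h1, h2⟩ := evenProbe_output E N K k (m := k * 2) finProdFinEquiv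
  have h0 : ∀ b, IsDensity (productChannel ![E b, Channel.id] (pureState (tmsvVec N))) := fun b =>
    isDensity_productChannel _ (norm_tmsvVec N)
  have hv : ∀ f, idlerProbe N e f = tmsvVec N (splitLabels ℕ (idlerPairs e) f).1 *
      evenProbe N finProdFinEquiv (splitLabels ℕ (idlerPairs e) f).2 := fun f => by
    rw [idlerProbe_apply, evenProbe_apply, mul_comm]
    simp only [splitLabels_snd, idlerPairs_inr, numberPairs_some]
    rfl
  have ht : ∀ i : Pattern m, IsTensor (splitLabels ℕ (idlerPairs e))
      (productChannel ![E (splitOption Bool (numberPairs e) i).1, Channel.id]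
        (pureState (tmsvVec N)))
      (patternOutput E (splitOption Bool (numberPairs e) i).2 (evenProbe N finProdFinEquiv))
      (patternOutputIdler E i (idlerProbe N e)) := fun i => by
    convert isTensor_productChannel (idlerPairs e)
      (Fin.snoc (fun s => E (i s)) Channel.id : Fin (m + 1) → Channel) hv using 1
    · congr 1
      funext s
      fin_cases s
      · exact (Fin.snoc_castSucc (α := fun _ => Channel) Channel.id (fun s => E (i s))
          (e none)).symm
      · exact (Fin.snoc_last (α := fun _ => Channel) Channel.id fun s => E (i s)).symm
    · unfold patternOutput
      congr 1
      funext s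
      rw [idlerPairs_inr, Fin.snoc_castSucc]
      rfl
    · rfl
  refine ⟨fun i => (ht i).isDensity (h0 _) (h1 _), ?_⟩
  rw [Fchoi, ← sum_bool_fidelity h0 K, ← h2]
  refine sum_sum_split (splitOption Bool (numberPairs e)) fun i i' => ?_
  rw [← mul_pow, (ht i).fidelity_eq (ht i') (h0 _) (h1 _) (h0 _) (h1 _)]

end Outputs

/-! ### Bounds on the error probability -/

section Bounds

theorem nonempty_povm {I X : Type} [Fintype I] [Nonempty I] : Nonempty (POVM I X) := by
  classical
  obtain ⟨i₀⟩ := ‹Nonempty I›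
  exact ⟨{
    effect := fun i => if i = i₀ then 1 else 0
    nonneg := fun i => by
      split_ifs
      exacts [zero_le_one, le_rfl]
    sum_eq_one := by simp }⟩

theorem sum_offDiag_fidelity {I X : Type} [Fintype I] [DecidableEq I] {ρ : I → Op X}
    (hρ : ∀ i, IsDensity (ρ i)) (K : ℕ) :
    ∑ i, ∑ j ∈ Finset.univ.filter (fun j => j ≠ i), fidelity (ρ i) (ρ j) ^ K =
      ∑ i, ∑ j, fidelity (ρ i) (ρ j) ^ K - Fintype.card I := by
  rw [eq_sub_iff_add_eq]
  have h : ∀ i, ∑ j, fidelity (ρ i) (ρ j) ^ K =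
      ∑ j ∈ Finset.univ.filter (fun j => j ≠ i), fidelity (ρ i) (ρ j) ^ K + 1 := fun i => by
    rw [Finset.filter_ne', ← Finset.add_sum_erase _ _ (Finset.mem_univ i), fidelity_self (hρ i),
      one_pow, add_comm]
  simp only [h, Finset.sum_add_distrib]
  simp

/-- Both bounds on the error probability in terms of sums of powers of fidelities. -/
theorem barcodeErrorProb_bounds {X : Type} {m M : ℕ} {ρ : Pattern m → Op X}
    (hρ : ∀ i, IsDensity (ρ i)) {a b : ℝ}
    (ha : ∑ i, ∑ j, fidelity (ρ i) (ρ j) ^ M = 2 ^ m * a)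
    (hb : ∑ i, ∑ j, fidelity (ρ i) (ρ j) ^ (2 * M) = 2 ^ m * b) :
    (b - 1) / 2 ^ (m + 1) ≤ barcodeErrorProb m M ρ ∧ barcodeErrorProb m M ρ ≤ a - 1 := by
  have hM := fun i => isDensity_tensorPow (hρ i) M
  have hcard : (Fintype.card (Pattern m) : ℝ) = 2 ^ m := by simp
  have h2 : (0 : ℝ) < 2 ^ m := by positivity
  constructor
  · have := nonempty_povm (I := Pattern m) (X := Fin M → X)
    -- With `c = 2^{-m}` the general bound equals `c² (2^m b - 2^m) / 2 = (b - 1) / 2^{m+1}`;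
    -- squaring the fidelity of `M` copies produces the exponent `2 * M`.
    refine le_ciInf fun P => le_trans (le_of_eq ?_) (half_sum_fidelity_sq_le_errorProb hM
      (c := 1 / 2 ^ m) (by positivity) (by rw [hcard]; field_simp) P)
    simp only [fidelity_tensorPow (hρ _) (hρ _), ← pow_mul, mul_comm M 2]
    rw [sum_offDiag_fidelity hρ, hb, hcard, pow_succ]
    field_simp
  · refine (minErrorProb_le_sum_fidelity hM (c := 1 / 2 ^ m) (by positivity)).trans (le_of_eq ?_)
    simp only [fidelity_tensorPow (hρ _) (hρ _)]
    rw [sum_offDiag_fidelity hρ, ha, hcard]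
    field_simp

end Bounds

end

end BosonicDiscrimination

theorem mainTheorem3 (E : Bool → Channel) (N : ℝ≥0) (M : ℕ) :
    -- the sub-fidelities depend only on the numbers of target channels
    (∀ i i' : Pattern 2,
      (targets i = 0 → targets i' = 1 → pairFidelity E N i i' = F01 E N) ∧
      (targets i = 1 → targets i' = 2 → pairFidelity E N i i' = F12 E N) ∧
      (targets i = 1 → targets i' = 1 → i ≠ i' → pairFidelity E N i i' = F11 E N) ∧
      (targets i = 0 → targets i' = 2 → pairFidelity E N i i' = F02 E N)) ∧
    -- even `m`
    (∀ (m : ℕ), Even m → ∀ e : Fin (m / 2) × Fin 2 ≃ Fin m,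
      (D2 E N (2 * M) ^ (m / 2) - 1) / 2 ^ (m + 1) ≤
        barcodeErrorProb m M (fun i => patternOutput E i (evenProbe N e)) ∧
      barcodeErrorProb m M (fun i => patternOutput E i (evenProbe N e)) ≤
        D2 E N M ^ (m / 2) - 1) ∧
    -- odd `m`, a coherent state probes the remaining channel
    (∀ (m : ℕ), Odd m → ∀ (e : Option (Fin ((m - 1) / 2) × Fin 2) ≃ Fin m) (α : ℂ),
      ((1 + Fcl E α ^ (2 * M)) * D2 E N (2 * M) ^ ((m - 1) / 2) - 1) / 2 ^ (m + 1) ≤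
        barcodeErrorProb m M (fun i => patternOutput E i (hybridProbe N α e)) ∧
      barcodeErrorProb m M (fun i => patternOutput E i (hybridProbe N α e)) ≤
        (1 + Fcl E α ^ M) * D2 E N M ^ ((m - 1) / 2) - 1) ∧
    -- odd `m`, the remaining channel is probed with the help of one idler
    (∀ (m : ℕ), Odd m → ∀ e : Option (Fin ((m - 1) / 2) × Fin 2) ≃ Fin m,
      ((1 + Fchoi E N ^ (2 * M)) * D2 E N (2 * M) ^ ((m - 1) / 2) - 1) / 2 ^ (m + 1) ≤
        barcodeErrorProb m M (fun i => patternOutputIdler E i (idlerProbe N e)) ∧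
      barcodeErrorProb m M (fun i => patternOutputIdler E i (idlerProbe N e)) ≤
        (1 + Fchoi E N ^ M) * D2 E N M ^ ((m - 1) / 2) - 1) := by
  refine ⟨pairFidelity_targets E N, fun m hm e => ?_, fun m hm e α => ?_, fun m hm e => ?_⟩
  -- Evenness enters through `4^(m/2) = 2^m`: a block of two channels has four patterns.
  · have h : ∀ K, (4 * D2 E N K) ^ (m / 2) = 2 ^ m * D2 E N K ^ (m / 2) := fun K => by
      rw [mul_pow]
      congr 1
      obtain ⟨k, rfl⟩ := hm
      rw [← two_mul, Nat.mul_div_cancel_left k two_pos, pow_mul]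
      norm_num
    exact barcodeErrorProb_bounds (evenProbe_output E N M _ e).1
      ((evenProbe_output E N M _ e).2.trans (h _)) ((evenProbe_output E N _ _ e).2.trans (h _))
  all_goals
    -- For odd `m` the two patterns of the remaining channel supply the missing factor: `2 ·
    -- 4^((m-1)/2) = 2^m`.
    have h : ∀ (K : ℕ) (x : ℝ), 2 * x * (4 * D2 E N K) ^ ((m - 1) / 2) =
        2 ^ m * (x * D2 E N K ^ ((m - 1) / 2)) := fun K x => by
      obtain ⟨k, rfl⟩ := hm
      rw [Nat.add_sub_cancel, Nat.mul_div_cancel_left k two_pos, pow_succ, pow_mul, mul_pow]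
      norm_num
      ring
  · exact barcodeErrorProb_bounds (hybridProbe_output E N α M _ e).1
      ((hybridProbe_output E N α M _ e).2.trans (h _ _))
      ((hybridProbe_output E N α _ _ e).2.trans (h _ _))
  · exact barcodeErrorProb_bounds (idlerProbe_output E N M _ e).1
      ((idlerProbe_output E N M _ e).2.trans (h _ _))
      ((idlerProbe_output E N _ _ e).2.trans (h _ _))
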